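/- For $A\in M_n(\mathbb C)$ and $1\le k\le n$ let $$\Lambda_k(A)=\{\lambda\in\mathbb C:\ PAP=\lambda P\ \text{for some rank-}k\text{ orthogonal projection }P\in M_n(\mathbb C)\}$$ be the rank-$k$ numerical range of $A$. Let $n\ge 1$, $\alpha,\beta,\zeta\in\mathbb C$, and let $T\in M_n(\mathbb C)$ be the tridiagonal matrix with main diagonal $(\alpha,\beta,\alpha,\beta,\dots)$, superdiagonal $(c_1,\dots,c_{n-1})$ and subdiagonal $(d_1,\dots,d_{n-1})$. Suppose that $\{1,\dots,n-1\}=J_1\sqcup J_2$ with $$c_j=\zeta\,\overline{d_j}\quad(j\in J_1)\qquad\text{and}\qquad d_j=\zeta\,\overline{c_j}\quad(j\in J_2).$$ Put $\tilde c_j=d_j$ for $j\in J_1$ and $\tilde c_j=c_j$ for $j\in J_2$, and let $B(\tilde c)$ be the $\lceil n/2\rceil\times\lfloor n/2\rfloor$ lower bidiagonal matrix with main diagonal $(\tilde c_1,\tilde c_3,\dots)$, subdiagonal $(\tilde c_2,\tilde c_4,\dots)$ and all other entries $0$. Let $p$ be the rank of $B(\tilde c)$ and let $s_1\ge\dots\ge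 s_p$ be its non-zero singular values, counted with multiplicity. For $1\le k\le p$ let $\Delta_k=(\alpha-\beta)^2+4\zeta s_k^2$ and let $\mathcal E_k$ be the (possibly degenerate) closed elliptical disc with foci $\tfrac12(\alpha+\beta)\pm\tfrac12\sqrt{\Delta_k}$ and with major and minor axes of lengths $$\sqrt{\tfrac12|\alpha-\beta|^2+(1+|\zeta|^2)s_k^2+\tfrac12|\Delta_k|}\qquad\text{and}\qquad\sqrt{\tfrac12|\alpha-\beta|^2+(1+|\zeta|^2)s_k^2-\tfrac12|\Delta_k|},$$ respectively. Let $[\alpha,\beta]$ be the line segment joining $\alpha$ and $\beta$ (the singleton $\{\alpha\}$ if $\alpha=\beta$). If $n=2r+1$, then $$\Lambda_k(T)=\begin{cases}\mathcal E_k, & 1\le k\le p,\\ [\alpha,\beta], & p<k\le r,\\ \{\alpha\}, & k=r+1,\\ \emptyset, & r+1<k\le n,\end{cases}$$ and if $n=2r$, then $$\Lambda_k(T)=\begin{cases}\mathcal E_k, & 1\le k\le p,\\ [\alpha,\beta], & p<k\le r,\\ \emptyset, & r<k\le n,\end{cases}$$ with one exception to the last line of each formula: if $\alpha=\beta$, then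 $\Lambda_k(T)=\{\alpha\}$ for all $k$ with $\lceil n/2\rceil<k\le n-p$ (such $k$ exist only if $p<\lfloor n/2\rfloor$), while $\Lambda_k(T)=\emptyset$ for $\lceil n/2\rceil<k\le n$ with $k>n-p$. -/

import Mathlib

open scoped ComplexConjugate

/-- The rank-`k` numerical range of a complex `n × n` matrix `A`: all `z` such that
`P A P = z P` for some orthogonal projection `P` of rank `k`. -/
def higherRankNumericalRange {n : ℕ} (k : ℕ) (A : Matrix (Fin n) (Fin n) ℂ) : Set ℂ :=
  {z | ∃ P : Matrix (Fin n) (Fin n) ℂ, IsStarProjection P ∧ P.rank = k ∧ P * A * P = z • P}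

/-- The tridiagonal matrix with subdiagonal `d`, main diagonal `a` and superdiagonal `c`. -/
def tridiagonal {n : ℕ} (d : Fin (n - 1) → ℂ) (a : Fin n → ℂ) (c : Fin (n - 1) → ℂ) :
    Matrix (Fin n) (Fin n) ℂ :=
  Matrix.of fun i j =>
    if i = j then a i
    else if h : (i : ℕ) + 1 = j then c ⟨i, by omega⟩
    else if h : (j : ℕ) + 1 = i then d ⟨j, by omega⟩
    else 0

/-- The vector `(α, β, α, β, …)` of length `n`. With indices starting at `0`, the entries of
even index are `α`. -/
def biperiodic {n : ℕ} (α β : ℂ) : Fin n → ℂ :=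
  fun i => if Even (i : ℕ) then α else β

/-- The `⌈n/2⌉ × ⌊n/2⌋` lower bidiagonal matrix of a vector `c = (c₁, …, c_{n-1})`, with main
diagonal `(c₁, c₃, …)` and subdiagonal `(c₂, c₄, …)`. In the code the indices start at `0`, so
that `c_j` is the entry of index `j - 1`. -/
def bidiagonal {n : ℕ} (c : Fin (n - 1) → ℂ) : Matrix (Fin ((n + 1) / 2)) (Fin (n / 2)) ℂ :=
  Matrix.of fun i j =>
    if (i : ℕ) = j then c ⟨2 * j, by omega⟩
    else if h : (i : ℕ) = j + 1 then c ⟨2 * j + 1, by omega⟩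
    else 0

/-- The `k`-th largest singular value of a matrix (`k = 1, 2, …`), counted with multiplicity.
Mathlib's sequence of singular values is decreasing and starts at index `0`. -/
noncomputable def singularValue {m n : ℕ} (B : Matrix (Fin m) (Fin n) ℂ) (k : ℕ) : ℝ :=
  (Matrix.toEuclideanLin B).singularValues (k - 1)

/-- `E` is the (possibly degenerate) closed elliptical disc with foci `f₁`, `f₂`, major axis of
length `a` and minor axis of length `b`. It is a circular disc if `f₁ = f₂` and a line segment
if `b = 0`. -/
def IsEllipticalDisc (E : Set ℂ) (f₁ f₂ : ℂ) (a b : ℝ) : Prop :=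
  0 ≤ a ∧ 0 ≤ b ∧ a ^ 2 = b ^ 2 + ‖f₁ - f₂‖ ^ 2 ∧ E = {z | ‖z - f₁‖ + ‖z - f₂‖ ≤ a}

open Matrix

/-! A point `z` lies in `Λ_k(T)` exactly when the form of `T - z` vanishes identically on some
`k`-dimensional subspace (`mem_higherRankNumericalRange_iff`). This reformulation is invariant under
all `*`-congruences, not only unitary ones, and that extra freedom drives the proof.

If `z ≠ α, β`, the diagonal of `T - z` has no zero. Then the factor `ζ` on any edge of the path can
be moved across the diagonal by a congruence (`StarCongruent.swap_blocks`,
`mixedTridiagonal_insert`), so the set `J₁` is irrelevant. For the best choice of that set, sorting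
the vertices by parity turns `T - z` into `[(α - z)I, B; ζB*, (β - z)I]`. A singular value
decomposition of `B` splits this into the blocks `[α - z, s; ζs, β - z]`, together with a leftover
`α - z` when `n` is odd. One isotropic vector from each of the first `k` blocks gives a frame;
conversely, a `k`-dimensional isotropic subspace contains a nonzero vector that avoids the `k - 1`
largest singular values. Hence for `1 ≤ k ≤ ⌊n/2⌋` the range is the numerical range of the single
matrix `[α, s_k; ζs_k, β]` (`range_mixedTridiagonal_eq_discImage`). It is an elliptical disc
(`isEllipticalDisc_discImage`), and the segment `[α, β]` once `s_k = 0`. The points `α` and `β`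
themselves are reached by coordinate subspaces.

For `k > ⌊n/2⌋` a dimension count leaves only `z = α`, and for `k > ⌈n/2⌉` it also forces `z = β`.
What remains is `α = β = z`, where the diagonal of `T - z` is zero. Independent sets of the path
then give isotropic coordinate subspaces, and the bound `2k ≤ n + dim ker` shows that a largest one,
of size `n - p`, is optimal (`mem_range_mixedTridiagonal_self_iff`). -/

/-- The sesquilinear form of `A` vanishes on some `k`-dimensional subspace (the range of `V`). -/
def HasIsotropicFrame {m : Type*} [Fintype m] (A : Matrix m m ℂ) (k : ℕ) : Prop :=
  ∃ V : Matrix m (Fin k) ℂ, (∀ x, V *ᵥ x = 0 → x = 0) ∧ Vᴴ * A * V = 0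

/-! ### Isotropic subspaces and `*`-congruence. -/

section Isotropic

variable {m n : Type*} [Fintype m] [Fintype n]

theorem HasIsotropicFrame.of_conjugate {A : Matrix m m ℂ} {k : ℕ} (G : Matrix m n ℂ)
    (hG : ∀ x, G *ᵥ x = 0 → x = 0) (h : HasIsotropicFrame (Gᴴ * A * G) k) :
    HasIsotropicFrame A k := by
  obtain ⟨V, hV, h0⟩ := h
  refine ⟨G * V, fun x hx => hV _ (hG _ ?_), ?_⟩
  · rwa [mulVec_mulVec]
  · rw [← h0, conjTranspose_mul]
    simp only [Matrix.mul_assoc]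

theorem HasIsotropicFrame.submatrix {A : Matrix m m ℂ} {k : ℕ} (h : HasIsotropicFrame A k)
    (e : n ≃ m) : HasIsotropicFrame (A.submatrix e e) k := by
  obtain ⟨V, hV, h0⟩ := h
  refine ⟨V.submatrix e id, fun x hx => hV x ?_, ?_⟩
  · ext i
    have := congrFun hx (e.symm i)
    simpa [mulVec, dotProduct] using this
  · rw [conjTranspose_submatrix, submatrix_mul_equiv, submatrix_mul_equiv, h0]
    rfl

theorem hasIsotropicFrame_submatrix {A : Matrix m m ℂ} {k : ℕ} (e : n ≃ m) :
    HasIsotropicFrame (A.submatrix e e) k ↔ HasIsotropicFrame A k :=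
  ⟨fun h => by simpa using h.submatrix e.symm, fun h => h.submatrix e⟩

theorem HasIsotropicFrame.form_eq_zero {A : Matrix m m ℂ} {k : ℕ} {V : Matrix m (Fin k) ℂ}
    (h0 : Vᴴ * A * V = 0) (x y : Fin k → ℂ) : star (V *ᵥ x) ⬝ᵥ A *ᵥ (V *ᵥ y) = 0 := by
  rw [star_mulVec, ← dotProduct_mulVec, mulVec_mulVec, mulVec_mulVec, h0]
  simp

/-- An isotropic subspace meets every coordinate subspace of small codimension. -/
theorem HasIsotropicFrame.exists_vector {A : Matrix m m ℂ} {k : ℕ} (h : HasIsotropicFrame A k)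
    (K : Finset m) (hK : K.card < k) :
    ∃ v : m → ℂ, v ≠ 0 ∧ (∀ i ∈ K, v i = 0) ∧ star v ⬝ᵥ A *ᵥ v = 0 := by
  obtain ⟨V, hV, h0⟩ := h
  let f : (Fin k → ℂ) →ₗ[ℂ] (K → ℂ) := LinearMap.funLeft ℂ ℂ (Subtype.val) ∘ₗ V.mulVecLin
  have hf : LinearMap.ker f ≠ ⊥ := f.ker_ne_bot_of_finrank_lt (by simpa using hK)
  obtain ⟨x, hx, hx0⟩ := (Submodule.ne_bot_iff _).1 hf
  refine ⟨V *ᵥ x, fun h => hx0 (hV x h), fun i hi => ?_, HasIsotropicFrame.form_eq_zero h0 x x⟩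
  exact congrFun (LinearMap.mem_ker.1 hx) ⟨i, hi⟩

-- `A` maps the isotropic subspace into its orthogonal complement, of dimension `|m| - k`, and it
-- loses at most `dim ker A` dimensions on the way.
open scoped ComplexOrder in
theorem HasIsotropicFrame.two_mul_le {A : Matrix m m ℂ} {k : ℕ} (h : HasIsotropicFrame A k) :
    2 * k ≤ Fintype.card m + Module.finrank ℂ (LinearMap.ker A.mulVecLin) := by
  obtain ⟨V, hV, h0⟩ := h
  have hVi : LinearMap.ker V.mulVecLin = ⊥ := LinearMap.ker_eq_bot'.2 hV
  have h1 : Module.finrank ℂ (LinearMap.range V.mulVecLin) = k := by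
    rw [LinearMap.finrank_range_of_inj (LinearMap.ker_eq_bot.1 hVi)]; simp
  have h2 : Vᴴ.rank = k := by rw [rank_conjTranspose]; exact h1
  have h3 := LinearMap.finrank_range_add_finrank_ker Vᴴ.mulVecLin
  have h4 : (LinearMap.range V.mulVecLin).map A.mulVecLin ≤ LinearMap.ker Vᴴ.mulVecLin := by
    rintro _ ⟨_, ⟨x, rfl⟩, rfl⟩
    simp [LinearMap.mem_ker, mulVec_mulVec, ← Matrix.mul_assoc, h0]
  have h5 := Submodule.finrank_mono h4
  have h6 := LinearMap.finrank_range_add_finrank_ker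
    (A.mulVecLin.domRestrict (LinearMap.range V.mulVecLin))
  rw [LinearMap.range_domRestrict, h1] at h6
  have h7 : Module.finrank ℂ
      (LinearMap.ker (A.mulVecLin.domRestrict (LinearMap.range V.mulVecLin))) ≤
      Module.finrank ℂ (LinearMap.ker A.mulVecLin) := by
    let g : LinearMap.ker (A.mulVecLin.domRestrict (LinearMap.range V.mulVecLin)) →ₗ[ℂ]
        LinearMap.ker A.mulVecLin :=
      LinearMap.codRestrict _ (Submodule.subtype _ ∘ₗ Submodule.subtype _) fun x => x.2
    refine LinearMap.finrank_le_finrank_of_injective (f := g) fun x y hxy => ?_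
    have h : (g x : m → ℂ) = g y := by rw [hxy]
    exact Subtype.ext (Subtype.ext h)
  have h8 : Vᴴ.rank = Module.finrank ℂ (LinearMap.range Vᴴ.mulVecLin) := rfl
  rw [← h8, h2] at h3
  simp only [Module.finrank_fintype_fun_eq_card] at h3
  omega

/-- `*`-congruence of square matrices. -/
def StarCongruent [DecidableEq m] (A B : Matrix m m ℂ) : Prop :=
  ∃ G : Matrix m m ℂ, IsUnit G ∧ Gᴴ * A * G = B

variable [DecidableEq m] [DecidableEq n]

theorem StarCongruent.refl (A : Matrix m m ℂ) : StarCongruent A A :=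
  ⟨1, isUnit_one, by simp⟩

theorem StarCongruent.trans {A B C : Matrix m m ℂ} (h : StarCongruent A B)
    (h' : StarCongruent B C) : StarCongruent A C := by
  obtain ⟨G, hG, rfl⟩ := h
  obtain ⟨H, hH, rfl⟩ := h'
  refine ⟨G * H, hG.mul hH, ?_⟩
  rw [conjTranspose_mul]
  simp only [Matrix.mul_assoc]

theorem StarCongruent.symm {A B : Matrix m m ℂ} (h : StarCongruent A B) :
    StarCongruent B A := by
  obtain ⟨G, hG, rfl⟩ := h
  have hd : IsUnit G.det := (isUnit_iff_isUnit_det G).1 hG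
  have hd' : IsUnit Gᴴ.det := by rw [det_conjTranspose]; exact hd.star
  refine ⟨G⁻¹, (isUnit_nonsing_inv_iff).2 hG, ?_⟩
  rw [conjTranspose_nonsing_inv, Matrix.mul_assoc, Matrix.mul_assoc Gᴴ, Matrix.mul_assoc Gᴴ,
    nonsing_inv_mul_cancel_left _ _ hd', Matrix.mul_assoc, mul_nonsing_inv _ hd, Matrix.mul_one]

theorem StarCongruent.of_submatrix {A B : Matrix m m ℂ} (e : n ≃ m)
    (h : StarCongruent (A.submatrix e e) (B.submatrix e e)) : StarCongruent A B := by
  obtain ⟨G, hG, h⟩ := h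
  refine ⟨G.submatrix e.symm e.symm, ?_, ?_⟩
  · rw [isUnit_iff_isUnit_det] at hG ⊢
    rwa [det_submatrix_equiv_self]
  · have : A = (A.submatrix e e).submatrix e.symm e.symm := by simp
    rw [this, conjTranspose_submatrix, submatrix_mul_equiv, submatrix_mul_equiv, h]
    simp

theorem StarCongruent.hasIsotropicFrame {A B : Matrix m m ℂ} (h : StarCongruent A B) {k : ℕ}
    (hB : HasIsotropicFrame B k) : HasIsotropicFrame A k := by
  obtain ⟨G, hG, rfl⟩ := h
  refine hB.of_conjugate G fun x hx => ?_
  exact mulVec_injective_iff_isUnit.2 hG (by simpa using hx)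

theorem StarCongruent.hasIsotropicFrame_iff {A B : Matrix m m ℂ} (h : StarCongruent A B) {k : ℕ} :
    HasIsotropicFrame A k ↔ HasIsotropicFrame B k :=
  ⟨h.symm.hasIsotropicFrame, h.hasIsotropicFrame⟩

/-- A frame of coordinate vectors. -/
theorem hasIsotropicFrame_of_coordinates {A : Matrix m m ℂ} {k : ℕ} (I : Finset m)
    (hI : k ≤ I.card) (hA : ∀ i ∈ I, ∀ j ∈ I, A i j = 0) : HasIsotropicFrame A k := by
  obtain ⟨f⟩ : Nonempty (Fin k ↪ I) := Function.Embedding.nonempty_of_card_le (by simpa using hI)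
  refine ⟨(1 : Matrix m m ℂ).submatrix id (fun i => (f i : m)), fun x hx => ?_, ?_⟩
  · ext i
    have := congrFun hx (f i)
    simpa [mulVec, dotProduct, Matrix.one_apply, Subtype.val_injective.eq_iff] using this
  · ext i j
    simp only [Matrix.mul_apply, conjTranspose_apply, submatrix_apply, Matrix.one_apply, id]
    simp [hA _ (f i).2 _ (f j).2]

-- The frame need not be orthonormal: a basis of the range of `P` gives `V`, and conversely
-- `V(V*V)⁻¹V*` is the orthogonal projection onto the range of `V`.
open scoped ComplexOrder in
theorem mem_higherRankNumericalRange_iff {n k : ℕ} {A : Matrix (Fin n) (Fin n) ℂ} {z : ℂ} :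
    z ∈ higherRankNumericalRange k A ↔ HasIsotropicFrame (A - z • 1) k := by
  constructor
  · rintro ⟨P, hP, hr, h⟩
    let b := Module.finBasisOfFinrankEq ℂ (LinearMap.range P.mulVecLin) (n := k) hr
    let V : Matrix (Fin n) (Fin k) ℂ := Matrix.of fun i j => (b j : Fin n → ℂ) i
    have hV : ∀ x, V *ᵥ x = ((∑ j, x j • b j : LinearMap.range P.mulVecLin) : Fin n → ℂ) := by
      intro x
      ext i
      simp [V, mulVec, dotProduct, mul_comm]
    have hPP : P * P = P := hP.isIdempotentElem
    have hPH : Pᴴ = P := hP.isSelfAdjoint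
    have hPV : P * V = V := by
      ext i j
      obtain ⟨y, hy⟩ := (b j).2
      have : P *ᵥ (b j : Fin n → ℂ) = b j := by
        rw [← hy]
        simp [mulVec_mulVec, hPP]
      exact congrFun this i
    refine ⟨V, fun x hx => ?_, ?_⟩
    · rw [hV] at hx
      have hx' : ∑ j, x j • b j = 0 := Subtype.ext hx
      ext i
      exact Fintype.linearIndependent_iff.1 b.linearIndependent x hx' i
    · have : Vᴴ * (A - z • 1) * V = Vᴴ * (P * (A - z • 1) * P) * V := by
        conv_lhs => rw [← hPV, conjTranspose_mul, hPH]
        simp only [Matrix.mul_assoc]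
      rw [this, Matrix.mul_sub, Matrix.sub_mul, h]
      simp [hPP]
  · rintro ⟨V, hV, h0⟩
    have hu : IsUnit (Vᴴ * V) := by
      rw [← mulVec_injective_iff_isUnit]
      intro x y hxy
      have : (Vᴴ * V) *ᵥ (x - y) = 0 := by rw [mulVec_sub, sub_eq_zero]; exact hxy
      rw [conjTranspose_mul_self_mulVec_eq_zero] at this
      exact sub_eq_zero.1 (hV _ this)
    have hd := (isUnit_iff_isUnit_det _).1 hu
    set N := (Vᴴ * V)⁻¹ with hN
    have hNH : Nᴴ = N := by
      rw [hN, conjTranspose_nonsing_inv, conjTranspose_mul, conjTranspose_conjTranspose]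
    have hPV : V * N * Vᴴ * V = V := by
      rw [Matrix.mul_assoc, Matrix.mul_assoc, hN, nonsing_inv_mul _ hd, Matrix.mul_one]
    have hPP : V * N * Vᴴ * (V * N * Vᴴ) = V * N * Vᴴ := by
      rw [← Matrix.mul_assoc, ← Matrix.mul_assoc, hPV]
    have hrV : V.rank = k := by
      have : LinearMap.ker V.mulVecLin = ⊥ := LinearMap.ker_eq_bot'.2 hV
      rw [Matrix.rank, LinearMap.finrank_range_of_inj (LinearMap.ker_eq_bot.1 this)]
      simp
    refine ⟨V * N * Vᴴ, ⟨hPP, ?_⟩, le_antisymm ?_ ?_, ?_⟩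
    · show (V * N * Vᴴ)ᴴ = _
      rw [conjTranspose_mul, conjTranspose_mul, conjTranspose_conjTranspose, hNH, Matrix.mul_assoc]
    · rw [Matrix.mul_assoc]
      exact (rank_mul_le_left _ _).trans hrV.le
    · calc k = (V * N * Vᴴ * V).rank := by rw [hPV, hrV]
        _ ≤ _ := rank_mul_le_left _ _
    · have : V * N * Vᴴ * (A - z • 1) * (V * N * Vᴴ) = 0 := by
        calc _ = V * N * (Vᴴ * (A - z • 1) * V) * (N * Vᴴ) := by simp only [Matrix.mul_assoc]
          _ = 0 := by rw [h0]; simp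
      rw [Matrix.mul_sub, Matrix.sub_mul, sub_eq_zero] at this
      rw [this]
      simp [hPP]

end Isotropic

/-! ### Rectangular diagonal matrices and the singular value decomposition. -/

/-- The rectangular diagonal matrix with entries `s 0, s 1, …`. -/
def rectDiagonal (m n : ℕ) (s : ℕ → ℂ) : Matrix (Fin m) (Fin n) ℂ :=
  Matrix.of fun i j => if (i : ℕ) = j then s j else 0

theorem rectDiagonal_mul {m n k : ℕ} (hkn : k ≤ n) (f g : ℕ → ℂ) :
    rectDiagonal m n f * rectDiagonal n k g = rectDiagonal m k fun j => f j * g j := by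
  ext i j
  rw [Matrix.mul_apply, Finset.sum_eq_single (Fin.castLE hkn j)]
  · simp [rectDiagonal]
  · intro l _ hl
    have : ¬ (l : ℕ) = j := fun h => hl (Fin.ext h)
    simp [rectDiagonal, this]
  · simp

theorem rectDiagonal_conjTranspose_mul {m n k : ℕ} (hkm : k ≤ m) (f g : ℕ → ℂ) :
    (rectDiagonal m n f)ᴴ * rectDiagonal m k g = rectDiagonal n k fun j => conj (f j) * g j := by
  ext i j
  rw [Matrix.mul_apply, Finset.sum_eq_single (Fin.castLE hkm j)]
  · by_cases h : (j : ℕ) = i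
    · simp [rectDiagonal, h]
    · simp [rectDiagonal, h, Ne.symm h]
  · intro l _ hl
    have : ¬ (l : ℕ) = j := fun h => hl (Fin.ext h)
    simp [rectDiagonal, this]
  · simp

theorem rectDiagonal_mulVec_apply {m n : ℕ} (f : ℕ → ℂ) (x : Fin n → ℂ) {i : Fin m} {j : Fin n}
    (h : (i : ℕ) = j) : (rectDiagonal m n f *ᵥ x) i = f j * x j := by
  rw [mulVec, dotProduct, Finset.sum_eq_single j]
  · simp [rectDiagonal, h]
  · intro l _ hl
    have : ¬ (i : ℕ) = l := fun h' => hl (Fin.ext (h'.symm.trans h))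
    simp [rectDiagonal, this]
  · simp

theorem singularValue_nonneg {m n : ℕ} (B : Matrix (Fin m) (Fin n) ℂ) (k : ℕ) :
    0 ≤ singularValue B k := LinearMap.singularValues_nonneg _ _

theorem singularValue_antitone {m n : ℕ} (B : Matrix (Fin m) (Fin n) ℂ) :
    Antitone (singularValue B) := fun _ _ h =>
  LinearMap.singularValues_antitone _ (Nat.sub_le_sub_right h 1)

theorem singularValue_eq_zero_of_rank_lt {m n : ℕ} (B : Matrix (Fin m) (Fin n) ℂ) {k : ℕ}
    (hk : B.rank < k) : singularValue B k = 0 := by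
  have h : B.rank = Module.finrank ℂ (LinearMap.range (Matrix.toEuclideanLin B)) :=
    Matrix.rank_eq_finrank_range_toLin B (PiLp.basisFun _ _ _) (PiLp.basisFun _ _ _)
  rw [singularValue, LinearMap.singularValues_eq_zero_iff_le_finrank_range, ← h]
  exact Nat.le_sub_one_of_lt hk

open Module in
/-- Orthonormal bases of singular vectors. -/
theorem exists_singular_bases {m n : ℕ} (hmn : n ≤ m)
    (T : EuclideanSpace ℂ (Fin n) →ₗ[ℂ] EuclideanSpace ℂ (Fin m)) :
    ∃ (f : OrthonormalBasis (Fin m) ℂ (EuclideanSpace ℂ (Fin m)))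
      (g : OrthonormalBasis (Fin n) ℂ (EuclideanSpace ℂ (Fin n))),
      ∀ j : Fin n, T (g j) = (T.singularValues j : ℂ) • f (Fin.castLE hmn j) := by
  have hn : finrank ℂ (EuclideanSpace ℂ (Fin n)) = n := by simp
  let g := T.isSymmetric_adjoint_comp_self.eigenvectorBasis hn
  have hin : ∀ i j, inner ℂ (T (g i)) (T (g j)) =
      if i = j then ((T.singularValues j : ℂ)) ^ 2 else 0 := by
    intro i j
    rw [← LinearMap.adjoint_inner_right, ← LinearMap.comp_apply,
      T.isSymmetric_adjoint_comp_self.apply_eigenvectorBasis hn, inner_smul_right,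
      ← T.sq_singularValues_fin hn, orthonormal_iff_ite.1 g.orthonormal]
    simp
  let v : Fin m → EuclideanSpace ℂ (Fin m) := fun i =>
    if h : (i : ℕ) < n then ((T.singularValues i : ℂ))⁻¹ • T (g ⟨i, h⟩) else 0
  let S : Set (Fin m) := {i | (i : ℕ) < n ∧ T.singularValues i ≠ 0}
  have hv : Orthonormal ℂ (S.domRestrict v) := by
    rw [orthonormal_iff_ite]
    rintro ⟨i, hi, hi0⟩ ⟨j, hj, hj0⟩
    have hj0' : (T.singularValues j : ℂ) ≠ 0 := by exact_mod_cast hj0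
    change inner ℂ (v i) (v j) = _
    simp only [v, hi, hj, dif_pos, inner_smul_left, inner_smul_right, hin]
    by_cases hij : i = j
    · subst hij
      simp only [if_true, map_inv₀, Complex.conj_ofReal]
      field_simp
    · have : ¬ (i : ℕ) = j := fun h => hij (Fin.ext h)
      simp [this, hij]
  obtain ⟨f, hf⟩ := hv.exists_orthonormalBasis_extension_of_card_eq (by simp)
  refine ⟨f, g, fun j => ?_⟩
  by_cases h0 : T.singularValues j = 0
  · have := hin j j
    rw [h0] at this ⊢
    simpa using this
  · rw [hf _ ⟨j.2, h0⟩]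
    have h0' : (T.singularValues j : ℂ) ≠ 0 := by exact_mod_cast h0
    simp only [v, Fin.val_castLE, j.2, dif_pos]
    rw [smul_inv_smul₀ h0']

theorem exists_singular_value_decomposition {m n : ℕ} (hmn : n ≤ m)
    (B : Matrix (Fin m) (Fin n) ℂ) :
    ∃ (F : Matrix (Fin m) (Fin m) ℂ) (G : Matrix (Fin n) (Fin n) ℂ), Fᴴ * F = 1 ∧ Gᴴ * G = 1 ∧
      Fᴴ * B * G = rectDiagonal m n fun j => (singularValue B (j + 1) : ℂ) := by
  obtain ⟨f, g, h⟩ := exists_singular_bases hmn (Matrix.toEuclideanLin B)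
  have key : ∀ (l : ℕ) (f : OrthonormalBasis (Fin l) ℂ (EuclideanSpace ℂ (Fin l)))
      (i : Fin l) (v : EuclideanSpace ℂ (Fin l)), ∑ x, star (f i x) * v x = inner ℂ (f i) v := by
    intro l f i v
    simp [PiLp.inner_apply, mul_comm]
  refine ⟨Matrix.of fun i j => f j i, Matrix.of fun i j => g j i, ?_, ?_, ?_⟩
  · ext i j
    simp only [Matrix.mul_apply, conjTranspose_apply, of_apply, key]
    rw [orthonormal_iff_ite.1 f.orthonormal, Matrix.one_apply]
  · ext i j
    simp only [Matrix.mul_apply, conjTranspose_apply, of_apply, key]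
    rw [orthonormal_iff_ite.1 g.orthonormal, Matrix.one_apply]
  · ext i j
    have h1 : ∀ x, ∑ y, B x y * g j y = (Matrix.toEuclideanLin B (g j)) x := by
      intro x
      simp [Matrix.toLpLin_apply, mulVec, dotProduct]
    rw [Matrix.mul_assoc]
    simp only [Matrix.mul_apply, conjTranspose_apply, of_apply, h1, key]
    rw [h, inner_smul_right, orthonormal_iff_ite.1 f.orthonormal]
    simp [rectDiagonal, singularValue, Fin.ext_iff]

/-! ### Moving `ζ` between the off-diagonal blocks. -/

section Swap

variable {m n : Type*} [Fintype m] [Fintype n] [DecidableEq m] [DecidableEq n]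

/-- The congruence is by the block matrix `[1, 0; p, Q]`; the hypotheses say that it fixes both
diagonal blocks and replaces the other two as required. -/
theorem StarCongruent.of_blocks {A : Matrix m m ℂ} {W W' : Matrix m n ℂ} {Z Z' : Matrix n m ℂ}
    {U : Matrix n n ℂ} (p : Matrix n m ℂ) (Q : Matrix n n ℂ) (hQ : IsUnit Q)
    (h₁₁ : W * p + pᴴ * (Z + U * p) = 0) (h₁₂ : (W + pᴴ * U) * Q = W')
    (h₂₁ : Qᴴ * (Z + U * p) = Z') (h₂₂ : Qᴴ * U * Q = U) :
    StarCongruent (fromBlocks A W Z U) (fromBlocks A W' Z' U) := by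
  refine ⟨fromBlocks 1 0 p Q, ?_, ?_⟩
  · rw [isUnit_iff_isUnit_det, det_fromBlocks_zero₁₂, det_one, one_mul]
    exact (isUnit_iff_isUnit_det _).1 hQ
  · rw [fromBlocks_conjTranspose, fromBlocks_multiply, fromBlocks_multiply, fromBlocks_inj]
    refine ⟨?_, ?_, ?_, ?_⟩
    · calc _ = A + (W * p + pᴴ * (Z + U * p)) := by
            simp only [conjTranspose_one, Matrix.one_mul, Matrix.mul_one, Matrix.add_mul,
              Matrix.mul_add, Matrix.mul_assoc]
            abel
        _ = A := by rw [h₁₁, add_zero]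
    · rw [← h₁₂]; simp
    · rw [← h₂₁]; simp [Matrix.mul_add, Matrix.mul_assoc]
    · simpa using h₂₂

/-- The factor `ζ` can be moved from one off-diagonal block to the other by a congruence. -/
theorem StarCongruent.swap_blocks (A : Matrix m m ℂ) (W : Matrix m n ℂ) (U : Matrix n n ℂ)
    {ζ q : ℂ} (hq : conj q * q = 1) (h : ‖ζ‖ = 1 ∨ IsUnit (conj ζ • U - Uᴴ)) :
    StarCongruent (fromBlocks A W (ζ • Wᴴ) U) (fromBlocks A ((ζ * q) • W) (conj q • Wᴴ) U) := by
  by_cases hζ : ‖ζ‖ = 1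
  · have hζ' : conj ζ * ζ = 1 := by rw [Complex.conj_mul', hζ]; simp
    have hu : conj (ζ * q) * (ζ * q) = 1 := by
      rw [map_mul, mul_mul_mul_comm, hζ', hq, one_mul]
    -- For `|ζ| = 1` it suffices to rescale the second block of coordinates by the unimodular number
    -- `ζq`.
    refine StarCongruent.of_blocks 0 ((ζ * q) • 1) ?_ (by simp) (by simp) ?_ ?_
    · rw [isUnit_iff_isUnit_det, det_smul, det_one, mul_one]
      exact (IsUnit.of_mul_eq_one_right _ hu).pow _
    · simp only [conjTranspose_smul, conjTranspose_one, Matrix.smul_mul, Matrix.one_mul,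
        Matrix.mul_zero, add_zero, smul_smul]
      congr 1
      change conj (ζ * q) * ζ = conj q
      rw [map_mul, mul_right_comm, hζ', one_mul]
    · simp only [conjTranspose_smul, conjTranspose_one, Matrix.smul_mul, Matrix.one_mul,
        Matrix.mul_smul, Matrix.mul_one, smul_smul]
      change ((ζ * q) * conj (ζ * q)) • U = U
      rw [mul_comm, hu, one_smul]
  · replace h := h.resolve_left hζ
    set R := conj ζ • U - Uᴴ with hR
    set X := R⁻¹ with hX
    have hd : IsUnit R.det := (isUnit_iff_isUnit_det R).1 h
    have hRX : R * X = 1 := mul_nonsing_inv R hd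
    have hXR : X * R = 1 := nonsing_inv_mul R hd
    have hRX' : Rᴴ * Xᴴ = 1 := by rw [← conjTranspose_mul, hXR, conjTranspose_one]
    have hXR' : Xᴴ * Rᴴ = 1 := by rw [← conjTranspose_mul, hRX, conjTranspose_one]
    set κ : ℂ := 1 - conj ζ * ζ with hκ
    have hκ0 : κ ≠ 0 := by
      rw [hκ, Complex.conj_mul', sub_ne_zero]
      intro h1
      apply hζ
      have : ‖ζ‖ ^ 2 = 1 := by exact_mod_cast h1.symm
      nlinarith [norm_nonneg ζ]
    have hκc : star κ = κ := by
      change conj κ = κ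
      simp [hκ, mul_comm]
    -- `U` is recovered from `R`, so every congruence that preserves `R` preserves `U`. The choice
    -- `Q = -q R⁻¹R*` is one, and `p = κR⁻¹W*` cancels the change in the first diagonal block.
    have hκU : κ • U = -(ζ • R + Rᴴ) := by
      ext i j
      simp [hR, hκ]
      ring
    have e1 : ζ • Wᴴ + U * (κ • (X * Wᴴ)) = -(Rᴴ * X * Wᴴ) := by
      rw [Matrix.mul_smul, ← Matrix.smul_mul, hκU, Matrix.neg_mul, Matrix.add_mul,
        Matrix.smul_mul, ← Matrix.mul_assoc, ← Matrix.mul_assoc, hRX, Matrix.one_mul]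
      abel
    have hp : (κ • (X * Wᴴ))ᴴ = κ • (W * Xᴴ) := by
      rw [conjTranspose_smul, conjTranspose_mul, conjTranspose_conjTranspose, hκc]
    have e2 : W + (κ • (X * Wᴴ))ᴴ * U = -(ζ • (W * Xᴴ * R)) := by
      rw [hp, Matrix.smul_mul, ← Matrix.mul_smul, hκU, Matrix.mul_neg, Matrix.mul_add,
        Matrix.mul_assoc W, Matrix.mul_assoc W, hXR', Matrix.mul_one, Matrix.mul_smul,
        Matrix.mul_smul, Matrix.mul_assoc W]
      abel
    have hQ : (-(q • (X * Rᴴ)))ᴴ = -(conj q • (R * Xᴴ)) := by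
      rw [conjTranspose_neg, conjTranspose_smul, conjTranspose_mul, conjTranspose_conjTranspose]
      rfl
    refine StarCongruent.of_blocks (κ • (X * Wᴴ)) (-(q • (X * Rᴴ))) ?_ ?_ ?_ ?_ ?_
    · refine IsUnit.of_mul_eq_one (-(conj q • (Xᴴ * R))) ?_
      rw [Matrix.neg_mul, Matrix.mul_neg, neg_neg, Matrix.smul_mul, Matrix.mul_smul, smul_smul,
        mul_comm q, hq, one_smul,
        show X * Rᴴ * (Xᴴ * R) = X * (Rᴴ * Xᴴ) * R by simp only [Matrix.mul_assoc], hRX',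
        Matrix.mul_one, hXR]
    · rw [e1, hp, Matrix.mul_smul, Matrix.mul_neg, Matrix.smul_mul]
      rw [show W * Xᴴ * (Rᴴ * X * Wᴴ) = W * (Xᴴ * Rᴴ) * X * Wᴴ by simp only [Matrix.mul_assoc],
        hXR', Matrix.mul_one, Matrix.mul_assoc]
      abel
    · rw [e2, Matrix.neg_mul, Matrix.mul_neg, neg_neg, Matrix.smul_mul, Matrix.mul_smul, smul_smul,
        show W * Xᴴ * R * (X * Rᴴ) = W * (Xᴴ * ((R * X) * Rᴴ)) by simp only [Matrix.mul_assoc],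
        hRX, Matrix.one_mul, hXR', Matrix.mul_one]
    · rw [e1, hQ, Matrix.neg_mul, Matrix.mul_neg, neg_neg, Matrix.smul_mul,
        show R * Xᴴ * (Rᴴ * X * Wᴴ) = R * ((Xᴴ * Rᴴ) * X) * Wᴴ by simp only [Matrix.mul_assoc],
        hXR', Matrix.one_mul, hRX, Matrix.one_mul]
    · have h1 : R * Xᴴ * (ζ • R + Rᴴ) * (X * Rᴴ) = ζ • R + Rᴴ := by
        rw [Matrix.mul_add, Matrix.add_mul, Matrix.mul_smul, Matrix.smul_mul,
          show R * Xᴴ * R * (X * Rᴴ) = R * (Xᴴ * ((R * X) * Rᴴ)) by simp only [Matrix.mul_assoc],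
          show R * Xᴴ * Rᴴ * (X * Rᴴ) = (R * ((Xᴴ * Rᴴ) * X)) * Rᴴ by simp only [Matrix.mul_assoc],
          hRX, hXR', Matrix.one_mul, Matrix.one_mul, hXR', hRX, Matrix.mul_one, Matrix.one_mul]
      have h2 : κ • (R * Xᴴ * U * (X * Rᴴ)) = κ • U := by
        rw [← Matrix.smul_mul, ← Matrix.mul_smul, hκU, Matrix.mul_neg, Matrix.neg_mul, h1]
      rw [hQ, Matrix.neg_mul, Matrix.neg_mul, Matrix.mul_neg, neg_neg, Matrix.smul_mul,
        Matrix.smul_mul, Matrix.mul_smul, smul_smul, hq, one_smul]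
      exact smul_right_injective _ hκ0 h2

end Swap

/-! ### Independence of the placement of `ζ`. -/

section Tridiagonal

variable {n : ℕ}

/-- The tridiagonal matrix whose off-diagonal pairs are `(c j, ζ * conj (c j))`, where the factor
`ζ` is put into the superdiagonal for `j ∈ J` and into the subdiagonal for `j ∉ J`. -/
def mixedTridiagonal (ζ : ℂ) (a : Fin n → ℂ) (c : Fin (n - 1) → ℂ) (J : Finset (Fin (n - 1))) :
    Matrix (Fin n) (Fin n) ℂ :=
  tridiagonal (fun j => if j ∈ J then c j else ζ * conj (c j)) a
    (fun j => if j ∈ J then ζ * conj (c j) else c j)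

theorem tridiagonal_apply_self (d c : Fin (n - 1) → ℂ) (a : Fin n → ℂ) (i : Fin n) :
    tridiagonal d a c i i = a i := by simp [tridiagonal]

theorem tridiagonal_apply_succ (d c : Fin (n - 1) → ℂ) (a : Fin n → ℂ) {i j : Fin n}
    (h : (i : ℕ) + 1 = j) : tridiagonal d a c i j = c ⟨i, by omega⟩ := by
  have h1 : i ≠ j := by rintro rfl; omega
  simp [tridiagonal, h1, h]

theorem tridiagonal_succ_apply (d c : Fin (n - 1) → ℂ) (a : Fin n → ℂ) {i j : Fin n}
    (h : (j : ℕ) + 1 = i) : tridiagonal d a c i j = d ⟨j, by omega⟩ := by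
  have h1 : i ≠ j := by rintro rfl; omega
  have h2 : ¬ (i : ℕ) + 1 = j := by omega
  simp [tridiagonal, h1, h2, h]

theorem tridiagonal_apply_of_ne (d c : Fin (n - 1) → ℂ) (a : Fin n → ℂ) {i j : Fin n}
    (h : i ≠ j) (h1 : (i : ℕ) + 1 ≠ j) (h2 : (j : ℕ) + 1 ≠ i) : tridiagonal d a c i j = 0 := by
  simp [tridiagonal, h, h1, h2]

/-- Swapping blocks yields `ζqc` where `ζ * conj c` is wanted; the phase `q` makes up for the
missing conjugation. -/
theorem exists_phase (c : ℂ) : ∃ q : ℂ, conj q * q = 1 ∧ q * c = conj c := by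
  by_cases hc : c = 0
  · exact ⟨1, by simp, by simp [hc]⟩
  · have hc' : conj c ≠ 0 := by simpa using hc
    refine ⟨conj c / c, ?_, by field_simp⟩
    simp only [map_div₀, Complex.conj_conj]
    field_simp

/-- Cutting the path at the edge `m` leaves off-diagonal blocks with a single possibly nonzero
entry, so swapping these blocks changes that edge alone. The edges beyond `m` must not yet be in
`J`; this makes the invertibility condition checkable. -/
theorem mixedTridiagonal_insert {ζ : ℂ} {a : Fin n → ℂ} (ha : ∀ i, a i ≠ 0) (c : Fin (n - 1) → ℂ)
    {J : Finset (Fin (n - 1))} (m : Fin (n - 1)) (hJ : ∀ j ∈ J, j < m) :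
    StarCongruent (mixedTridiagonal ζ a c J) (mixedTridiagonal ζ a c (insert m J)) := by
  have hm : m ∉ J := fun h => lt_irrefl _ (hJ m h)
  have hJ' : ∀ j : Fin (n - 1), m < j → j ∉ J := fun j hj h => lt_asymm hj (hJ j h)
  obtain ⟨q, hq, hqc⟩ := exists_phase (c m)
  let e := Equiv.sumCompl fun i : Fin n => (i : ℕ) ≤ m
  refine StarCongruent.of_submatrix e ?_
  set T := (mixedTridiagonal ζ a c J).submatrix e e with hT
  have h1 : T = fromBlocks T.toBlocks₁₁ T.toBlocks₁₂ (ζ • T.toBlocks₁₂ᴴ) T.toBlocks₂₂ := by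
    conv_lhs => rw [← fromBlocks_toBlocks T]
    rw [fromBlocks_inj]
    refine ⟨rfl, rfl, ?_, rfl⟩
    ext ⟨i, hi⟩ ⟨j, hj⟩
    simp only [hT, toBlocks₂₁, toBlocks₁₂, of_apply, submatrix_apply, e, Equiv.sumCompl_apply_inl,
      Equiv.sumCompl_apply_inr, Matrix.smul_apply, conjTranspose_apply, mixedTridiagonal]
    by_cases hij : (j : ℕ) + 1 = i
    · have : (⟨j, by omega⟩ : Fin (n - 1)) = m := Fin.ext (by simp; omega)
      rw [tridiagonal_succ_apply _ _ _ hij, tridiagonal_apply_succ _ _ _ hij, this]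
      simp [hm]
    · have h1 : i ≠ j := by rintro rfl; omega
      rw [tridiagonal_apply_of_ne _ _ _ h1 (by omega) hij,
        tridiagonal_apply_of_ne _ _ _ h1.symm hij (by omega)]
      simp
  have h2 : (mixedTridiagonal ζ a c (insert m J)).submatrix e e =
      fromBlocks T.toBlocks₁₁ ((ζ * q) • T.toBlocks₁₂) (conj q • T.toBlocks₁₂ᴴ) T.toBlocks₂₂ := by
    rw [← fromBlocks_toBlocks ((mixedTridiagonal ζ a c (insert m J)).submatrix e e),
      fromBlocks_inj]
    have hne : ∀ {i : ℕ} (hi : i < n - 1), i ≠ m → ((⟨i, hi⟩ ∈ insert m J) ↔ ⟨i, hi⟩ ∈ J) := by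
      intro i hi h
      simp [Fin.ext_iff, h]
    refine ⟨?_, ?_, ?_, ?_⟩
    · ext ⟨i, hi⟩ ⟨j, hj⟩
      simp only [hT, toBlocks₁₁, of_apply, submatrix_apply, e, Equiv.sumCompl_apply_inl,
        mixedTridiagonal]
      by_cases h0 : i = j
      · subst h0; rw [tridiagonal_apply_self, tridiagonal_apply_self]
      by_cases h1 : (i : ℕ) + 1 = j
      · rw [tridiagonal_apply_succ _ _ _ h1, tridiagonal_apply_succ _ _ _ h1]
        simp only [hne (show (i : ℕ) < n - 1 by omega) (by omega)]
      by_cases h2 : (j : ℕ) + 1 = i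
      · rw [tridiagonal_succ_apply _ _ _ h2, tridiagonal_succ_apply _ _ _ h2]
        simp only [hne (show (j : ℕ) < n - 1 by omega) (by omega)]
      rw [tridiagonal_apply_of_ne _ _ _ h0 h1 h2, tridiagonal_apply_of_ne _ _ _ h0 h1 h2]
    · ext ⟨i, hi⟩ ⟨j, hj⟩
      simp only [hT, toBlocks₁₂, of_apply, submatrix_apply, e, Equiv.sumCompl_apply_inl,
        Equiv.sumCompl_apply_inr, Matrix.smul_apply, mixedTridiagonal]
      by_cases hij : (i : ℕ) + 1 = j
      · have : (⟨i, by omega⟩ : Fin (n - 1)) = m := Fin.ext (by simp; omega)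
        rw [tridiagonal_apply_succ _ _ _ hij, tridiagonal_apply_succ _ _ _ hij, this]
        simp [hm, mul_assoc, hqc]
      · have h1 : i ≠ j := by rintro rfl; omega
        rw [tridiagonal_apply_of_ne _ _ _ h1 hij (by omega),
          tridiagonal_apply_of_ne _ _ _ h1 hij (by omega)]
        simp
    · ext ⟨i, hi⟩ ⟨j, hj⟩
      simp only [hT, toBlocks₂₁, toBlocks₁₂, of_apply, submatrix_apply, e,
        Equiv.sumCompl_apply_inl, Equiv.sumCompl_apply_inr, Matrix.smul_apply, conjTranspose_apply,
        mixedTridiagonal]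
      by_cases hij : (j : ℕ) + 1 = i
      · have : (⟨j, by omega⟩ : Fin (n - 1)) = m := Fin.ext (by simp; omega)
        rw [tridiagonal_succ_apply _ _ _ hij, tridiagonal_apply_succ _ _ _ hij, this]
        simp only [hm, Finset.mem_insert_self, if_true, if_false, smul_eq_mul]
        change c m = conj q * conj (c m)
        rw [← map_mul, hqc, Complex.conj_conj]
      · have h1 : i ≠ j := by rintro rfl; omega
        rw [tridiagonal_apply_of_ne _ _ _ h1 (by omega) hij,
          tridiagonal_apply_of_ne _ _ _ h1.symm hij (by omega)]
        simp
    · ext ⟨i, hi⟩ ⟨j, hj⟩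
      simp only [hT, toBlocks₂₂, of_apply, submatrix_apply, e, Equiv.sumCompl_apply_inr,
        mixedTridiagonal]
      by_cases h0 : i = j
      · subst h0; rw [tridiagonal_apply_self, tridiagonal_apply_self]
      by_cases h1 : (i : ℕ) + 1 = j
      · rw [tridiagonal_apply_succ _ _ _ h1, tridiagonal_apply_succ _ _ _ h1]
        simp only [hne (show (i : ℕ) < n - 1 by omega) (by omega)]
      by_cases h2 : (j : ℕ) + 1 = i
      · rw [tridiagonal_succ_apply _ _ _ h2, tridiagonal_succ_apply _ _ _ h2]
        simp only [hne (show (j : ℕ) < n - 1 by omega) (by omega)]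
      rw [tridiagonal_apply_of_ne _ _ _ h0 h1 h2, tridiagonal_apply_of_ne _ _ _ h0 h1 h2]
  rw [h2]
  conv => arg 1; rw [h1]
  refine StarCongruent.swap_blocks _ _ _ hq (or_iff_not_imp_left.2 fun hζ => ?_)
  -- Beyond `m` every factor `ζ` is in the subdiagonal, so the superdiagonal entries `conj ζ * c -
  -- conj (ζ * conj c)` of `R` vanish. Its diagonal entries `conj ζ * a - conj a` are nonzero
  -- because `|ζ| ≠ 1` and `a ≠ 0`.
  rw [isUnit_iff_isUnit_det, det_of_isLowerTriangular, isUnit_iff_ne_zero, Finset.prod_ne_zero_iff]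
  · rintro ⟨i, hi⟩ -
    simp only [hT, toBlocks₂₂, Matrix.sub_apply, Matrix.smul_apply, conjTranspose_apply, of_apply,
      submatrix_apply, e, Equiv.sumCompl_apply_inr, mixedTridiagonal, tridiagonal_apply_self]
    intro h
    have h3 : ‖conj ζ • a i‖ = ‖star (a i)‖ := by rw [sub_eq_zero.1 h]
    rw [norm_smul, norm_star, RCLike.norm_conj] at h3
    exact hζ ((mul_eq_right₀ (norm_ne_zero_iff.2 (ha i))).1 h3)
  · rintro ⟨i, hi⟩ ⟨j, hj⟩ hij
    have hij' : (i : ℕ) < j := hij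
    simp only [hT, toBlocks₂₂, Matrix.sub_apply, Matrix.smul_apply, conjTranspose_apply, of_apply,
      submatrix_apply, e, Equiv.sumCompl_apply_inr, mixedTridiagonal]
    by_cases h : (i : ℕ) + 1 = j
    · rw [tridiagonal_apply_succ _ _ _ h, tridiagonal_succ_apply _ _ _ h]
      have := hJ' ⟨i, by omega⟩ (Fin.lt_def.2 (by simp; omega))
      simp [this]
    · have h1 : i ≠ j := by rintro rfl; omega
      rw [tridiagonal_apply_of_ne _ _ _ h1 h (by omega),
        tridiagonal_apply_of_ne _ _ _ h1.symm (by omega) h]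
      simp

theorem mixedTridiagonal_starCongruent {ζ : ℂ} {a : Fin n → ℂ} (ha : ∀ i, a i ≠ 0)
    (c : Fin (n - 1) → ℂ) (J J' : Finset (Fin (n - 1))) :
    StarCongruent (mixedTridiagonal ζ a c J) (mixedTridiagonal ζ a c J') := by
  have key : ∀ J, StarCongruent (mixedTridiagonal ζ a c ∅) (mixedTridiagonal ζ a c J) := by
    intro J
    -- Adding the edges in increasing order keeps the part of the path beyond the new edge
    -- untouched.
    induction J using Finset.induction_on_max with
    | empty => exact StarCongruent.refl _
    | insert m J hJ ih => exact ih.trans (mixedTridiagonal_insert ha c m hJ)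
  exact (key J).symm.trans (key J')

end Tridiagonal

/-! ### Linear images of the unit ball of `ℝ³` in the plane. -/

section Ellipse

/-- The image of the unit ball of `ℝ × ℂ` under
`(u, τ) ↦ (α + β) / 2 + (α - β) / 2 * u + s / 2 * (τ + ζ * conj τ)`. -/
def discImage (α β ζ : ℂ) (s : ℝ) : Set ℂ :=
  {z | ∃ (u : ℝ) (τ : ℂ), u ^ 2 + ‖τ‖ ^ 2 ≤ 1 ∧
    z = (α + β) / 2 + (α - β) / 2 * u + s / 2 * (τ + ζ * conj τ)}

theorem discImage_mono (α β ζ : ℂ) {s t : ℝ} (hs : 0 ≤ s) (hst : s ≤ t) :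
    discImage α β ζ s ⊆ discImage α β ζ t := by
  rintro z ⟨u, τ, h, rfl⟩
  rcases eq_or_lt_of_le (hs.trans hst) with ht | ht
  · have : s = t := by linarith
    subst this
    exact ⟨u, τ, h, rfl⟩
  · refine ⟨u, (s / t : ℝ) * τ, ?_, ?_⟩
    · have h1 : s / t ≤ 1 := (div_le_one ht).2 hst
      have h0 : 0 ≤ s / t := by positivity
      rw [norm_mul, Complex.norm_real, Real.norm_of_nonneg h0]
      have : (s / t * ‖τ‖) ^ 2 ≤ ‖τ‖ ^ 2 := by
        apply pow_le_pow_left₀ (by positivity)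
        exact mul_le_of_le_one_left (norm_nonneg _) h1
      linarith
    · have ht' : (t : ℂ) ≠ 0 := by exact_mod_cast ht.ne'
      rw [map_mul, Complex.conj_ofReal]
      push_cast
      field_simp

theorem discImage_zero (α β ζ : ℂ) : discImage α β ζ 0 = segment ℝ α β := by
  ext z
  rw [segment_eq_image]
  constructor
  · rintro ⟨u, τ, h, rfl⟩
    have hu : u ^ 2 ≤ 1 := by nlinarith [sq_nonneg ‖τ‖]
    have hu' := abs_le.1 ((sq_le_one_iff_abs_le_one u).1 hu)
    refine ⟨(1 - u) / 2, ⟨by linarith [hu'.2], by linarith [hu'.1]⟩, ?_⟩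
    simp only [Complex.real_smul]
    push_cast
    ring
  · rintro ⟨t, ⟨h0, h1⟩, rfl⟩
    refine ⟨1 - 2 * t, 0, ?_, ?_⟩
    · simp only [norm_zero]
      nlinarith
    · simp only [Complex.real_smul]
      push_cast
      ring

theorem eq_zero_of_sum_three_sq_nonpos {x y z : ℝ} (h : x ^ 2 + y ^ 2 + z ^ 2 ≤ 0) :
    x = 0 ∧ y = 0 ∧ z = 0 := by
  have hx := sq_nonneg x
  have hy := sq_nonneg y
  have hz := sq_nonneg z
  refine ⟨?_, ?_, ?_⟩ <;> exact pow_eq_zero_iff two_ne_zero |>.1 (by linarith)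

/-- A plane ellipse in terms of the Gram matrix of the linear map that maps the ball onto it. -/
theorem exists_mem_ball_of_gram {p q r p' q' r' x y : ℝ}
    (h1 : x ^ 2 + y ^ 2 ≤ p ^ 2 + q ^ 2 + r ^ 2 + (p' ^ 2 + q' ^ 2 + r' ^ 2))
    (h2 : (p' ^ 2 + q' ^ 2 + r' ^ 2) * x ^ 2 - 2 * (p * p' + q * q' + r * r') * (x * y)
      + (p ^ 2 + q ^ 2 + r ^ 2) * y ^ 2 ≤
      (p ^ 2 + q ^ 2 + r ^ 2) * (p' ^ 2 + q' ^ 2 + r' ^ 2) - (p * p' + q * q' + r * r') ^ 2) :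
    ∃ u v w : ℝ, u ^ 2 + v ^ 2 + w ^ 2 ≤ 1 ∧ p * u + q * v + r * w = x ∧
      p' * u + q' * v + r' * w = y := by
  set a := p ^ 2 + q ^ 2 + r ^ 2 with ha
  set b := p' ^ 2 + q' ^ 2 + r' ^ 2 with hb
  set c := p * p' + q * q' + r * r' with hc
  have ha0 : 0 ≤ a := by positivity
  have hb0 : 0 ≤ b := by positivity
  have hL : a * b - c ^ 2 = (q * r' - r * q') ^ 2 + (r * p' - p * r') ^ 2
      + (p * q' - q * p') ^ 2 := by
    rw [ha, hb, hc]; ring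
  by_cases hd : a * b - c ^ 2 = 0
  -- When the Gram determinant is zero, the quadratic inequality only says that `(x, y)` is on the
  -- line containing the image; the trace bound `h1` then limits its length.
  · have hs : (x * p' - y * p) ^ 2 + (x * q' - y * q) ^ 2 + (x * r' - y * r) ^ 2 ≤ 0 := by
      rw [hd] at h2
      calc _ = b * x ^ 2 - 2 * c * (x * y) + a * y ^ 2 := by rw [ha, hb, hc]; ring
        _ ≤ 0 := h2
    obtain ⟨f1, f2, f3⟩ := eq_zero_of_sum_three_sq_nonpos hs
    have hab : 0 ≤ a + b := by positivity
    rcases eq_or_lt_of_le hab with h0 | h0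
    · have ha' : a = 0 := by linarith
      have hb' : b = 0 := by linarith
      obtain ⟨hx, hy, -⟩ := eq_zero_of_sum_three_sq_nonpos (x := x) (y := y) (z := 0) (by linarith)
      exact ⟨0, 0, 0, by simp, by simp [hx], by simp [hy]⟩
    · -- the adjoint of the rank-one map, divided by its trace
      have g : ∀ {l l' : ℝ}, x * l' - y * l = 0 →
          (x * l + y * l') ^ 2 = (x ^ 2 + y ^ 2) * (l ^ 2 + l' ^ 2) := by
        intro l l' h
        linear_combination -(x * l' - y * l) * h
      refine ⟨(x * p + y * p') / (a + b), (x * q + y * q') / (a + b), (x * r + y * r') / (a + b),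
        ?_, ?_, ?_⟩
      · rw [div_pow, div_pow, div_pow, g f1, g f2, g f3, ← add_div, ← add_div,
          div_le_one (by positivity)]
        calc _ = (x ^ 2 + y ^ 2) * (a + b) := by rw [ha, hb]; ring
          _ ≤ (a + b) * (a + b) := by gcongr
          _ = _ := by ring
      · field_simp
        rw [ha, hb]
        linear_combination (-p') * f1 - q' * f2 - r' * f3
      · field_simp
        rw [ha, hb]
        linear_combination p * f1 + q * f2 + r * f3
  · have hpos : 0 < a * b - c ^ 2 := lt_of_le_of_ne (by rw [hL]; positivity) (Ne.symm hd)
    set e := a * b - c ^ 2 with he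
    -- The preimage of least norm, `Lᵀ(LLᵀ)⁻¹(x, y)`, where `L` has rows `(p, q, r)` and `(p', q',
    -- r')`.
    refine ⟨((x * b - y * c) * p + (y * a - x * c) * p') / e,
      ((x * b - y * c) * q + (y * a - x * c) * q') / e,
      ((x * b - y * c) * r + (y * a - x * c) * r') / e, ?_, ?_, ?_⟩
    · rw [div_pow, div_pow, div_pow, ← add_div, ← add_div, div_le_one (by positivity)]
      calc _ = (x * b - y * c) ^ 2 * a + 2 * (x * b - y * c) * (y * a - x * c) * c
            + (y * a - x * c) ^ 2 * b := by rw [ha, hb, hc]; ring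
        _ = e * (b * x ^ 2 - 2 * c * (x * y) + a * y ^ 2) := by rw [he]; ring
        _ ≤ e * e := by gcongr
        _ = e ^ 2 := by ring
    · field_simp
      calc _ = (x * b - y * c) * a + (y * a - x * c) * c := by rw [ha, hc]; ring
        _ = _ := by rw [he]; ring
    · field_simp
      calc _ = (x * b - y * c) * c + (y * a - x * c) * b := by rw [hb, hc]; ring
        _ = _ := by rw [he]; ring

theorem gram_of_mem_ball {p q r p' q' r' u v w : ℝ} (h : u ^ 2 + v ^ 2 + w ^ 2 ≤ 1) :
    (p * u + q * v + r * w) ^ 2 + (p' * u + q' * v + r' * w) ^ 2 ≤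
      p ^ 2 + q ^ 2 + r ^ 2 + (p' ^ 2 + q' ^ 2 + r' ^ 2) ∧
    (p' ^ 2 + q' ^ 2 + r' ^ 2) * (p * u + q * v + r * w) ^ 2
      - 2 * (p * p' + q * q' + r * r') * ((p * u + q * v + r * w) * (p' * u + q' * v + r' * w))
      + (p ^ 2 + q ^ 2 + r ^ 2) * (p' * u + q' * v + r' * w) ^ 2 ≤
      (p ^ 2 + q ^ 2 + r ^ 2) * (p' ^ 2 + q' ^ 2 + r' ^ 2) - (p * p' + q * q' + r * r') ^ 2 := by
  have cs : ∀ p q r : ℝ, (p * u + q * v + r * w) ^ 2 ≤ p ^ 2 + q ^ 2 + r ^ 2 := by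
    intro p q r
    calc _ = (p ^ 2 + q ^ 2 + r ^ 2) * (u ^ 2 + v ^ 2 + w ^ 2) - ((p * v - q * u) ^ 2
          + (p * w - r * u) ^ 2 + (q * w - r * v) ^ 2) := by ring
      _ ≤ (p ^ 2 + q ^ 2 + r ^ 2) * 1 - 0 := by gcongr; positivity
      _ = _ := by ring
  refine ⟨add_le_add (cs p q r) (cs p' q' r'), ?_⟩
  -- `N` is the squared length of the cross product of the two rows. The left side is the squared
  -- length of its cross product with `(u, v, w)`, and Lagrange's identity applies.
  set N := (q * r' - r * q') ^ 2 + (r * p' - p * r') ^ 2 + (p * q' - q * p') ^ 2 with hN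
  calc _ = N * (u ^ 2 + v ^ 2 + w ^ 2) - ((q * r' - r * q') * u + (r * p' - p * r') * v
        + (p * q' - q * p') * w) ^ 2 := by rw [hN]; ring
    _ ≤ N * 1 - 0 := by gcongr; positivity
    _ = _ := by rw [hN]; ring

/-- A linear map `ℝ³ → ℝ²` maps the unit sphere onto the image of the unit ball. -/
theorem exists_mem_sphere_of_mem_ball {p q r p' q' r' u v w : ℝ} (h : u ^ 2 + v ^ 2 + w ^ 2 ≤ 1) :
    ∃ u' v' w' : ℝ, u' ^ 2 + v' ^ 2 + w' ^ 2 = 1 ∧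
      p * u' + q * v' + r * w' = p * u + q * v + r * w ∧
      p' * u' + q' * v' + r' * w' = p' * u + q' * v + r' * w := by
  -- Moving along a kernel vector does not change the image, and the line through the given point
  -- meets the sphere; `t` below is a root of the resulting quadratic equation.
  obtain ⟨k, hk, hk0⟩ : ∃ k ∈ LinearMap.ker (!![p, q, r; p', q', r']).mulVecLin, k ≠ 0 := by
    refine (Submodule.ne_bot_iff _).1 (LinearMap.ker_ne_bot_of_finrank_lt ?_)
    simp
  have hk1 : p * k 0 + q * k 1 + r * k 2 = 0 := by
    have := congrFun (LinearMap.mem_ker.1 hk) 0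
    simpa [mulVec, dotProduct, Fin.sum_univ_three] using this
  have hk2 : p' * k 0 + q' * k 1 + r' * k 2 = 0 := by
    have := congrFun (LinearMap.mem_ker.1 hk) 1
    simpa [mulVec, dotProduct, Fin.sum_univ_three] using this
  have hA : 0 < k 0 ^ 2 + k 1 ^ 2 + k 2 ^ 2 := by
    refine lt_of_le_of_ne (by positivity) fun h0 => hk0 ?_
    obtain ⟨h1, h2, h3⟩ := eq_zero_of_sum_three_sq_nonpos h0.ge
    ext i
    fin_cases i
    exacts [h1, h2, h3]
  set A := k 0 ^ 2 + k 1 ^ 2 + k 2 ^ 2 with hAd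
  set B := u * k 0 + v * k 1 + w * k 2 with hB
  set D := B ^ 2 + A * (1 - (u ^ 2 + v ^ 2 + w ^ 2)) with hD
  have hD0 : 0 ≤ D := by
    have : 0 ≤ 1 - (u ^ 2 + v ^ 2 + w ^ 2) := by linarith
    positivity
  set t := (-B + √D) / A with ht
  have hq : A * t ^ 2 + 2 * B * t = 1 - (u ^ 2 + v ^ 2 + w ^ 2) := by
    have hs := Real.sq_sqrt hD0
    have h1 : A * t = -B + √D := by rw [ht]; field_simp
    have h2 : A * (A * t ^ 2 + 2 * B * t) = A * (1 - (u ^ 2 + v ^ 2 + w ^ 2)) := by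
      calc _ = (A * t) ^ 2 + 2 * B * (A * t) := by ring
        _ = √D ^ 2 - B ^ 2 := by rw [h1]; ring
        _ = _ := by rw [hs, hD]; ring
    exact mul_left_cancel₀ hA.ne' h2
  refine ⟨u + t * k 0, v + t * k 1, w + t * k 2, ?_, ?_, ?_⟩
  · calc _ = u ^ 2 + v ^ 2 + w ^ 2 + (A * t ^ 2 + 2 * B * t) := by rw [hAd, hB]; ring
      _ = 1 := by rw [hq]; ring
  · linear_combination t * hk1
  · linear_combination t * hk2

end Ellipse

/-! ### The elliptical range theorem for two-by-two matrices. -/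

section EllipticalDisc

theorem mem_discImage_iff {α β ζ z : ℂ} {s : ℝ} :
    z ∈ discImage α β ζ s ↔ ∃ u v w : ℝ, u ^ 2 + v ^ 2 + w ^ 2 ≤ 1 ∧
      ((α - β) / 2).re * u + s / 2 * (1 + ζ.re) * v + s / 2 * ζ.im * w = (z - (α + β) / 2).re ∧
      ((α - β) / 2).im * u + s / 2 * ζ.im * v + s / 2 * (1 - ζ.re) * w
        = (z - (α + β) / 2).im := by
  have hs : (s : ℂ) / 2 = ((s / 2 : ℝ) : ℂ) := by push_cast; rfl
  have key : ∀ (u : ℝ) (τ : ℂ), z = (α + β) / 2 + (α - β) / 2 * u + s / 2 * (τ + ζ * conj τ) ↔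
      ((α - β) / 2).re * u + s / 2 * (1 + ζ.re) * τ.re + s / 2 * ζ.im * τ.im
        = (z - (α + β) / 2).re ∧
      ((α - β) / 2).im * u + s / 2 * ζ.im * τ.re + s / 2 * (1 - ζ.re) * τ.im
        = (z - (α + β) / 2).im := by
    intro u τ
    rw [add_assoc, ← sub_eq_iff_eq_add', Complex.ext_iff, hs]
    generalize (α - β) / 2 = h
    generalize z - (α + β) / 2 = w
    simp only [Complex.add_re, Complex.add_im, Complex.mul_re, Complex.mul_im, Complex.ofReal_re,
      Complex.ofReal_im, Complex.conj_re, Complex.conj_im]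
    constructor
    · rintro ⟨h1, h2⟩
      exact ⟨by rw [h1]; ring, by rw [h2]; ring⟩
    · rintro ⟨h1, h2⟩
      exact ⟨by rw [← h1]; ring, by rw [← h2]; ring⟩
  have hn : ∀ τ : ℂ, ‖τ‖ ^ 2 = τ.re ^ 2 + τ.im ^ 2 := fun τ => by
    rw [Complex.sq_norm, Complex.normSq_apply]; ring
  constructor
  · rintro ⟨u, τ, h, hz⟩
    rw [hn, ← add_assoc] at h
    exact ⟨u, τ.re, τ.im, h, (key u τ).1 hz⟩
  · rintro ⟨u, v, w, h, hz⟩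
    exact ⟨u, ⟨v, w⟩, by rw [hn, ← add_assoc]; exact h, (key u ⟨v, w⟩).2 hz⟩

/-- The points of `discImage` are the values of the form of `!![α, s; ζ * s, β]` at unit
vectors. -/
theorem exists_unit_vector_of_mem_discImage {α β ζ z : ℂ} {s : ℝ} (hz : z ∈ discImage α β ζ s) :
    ∃ (x : ℝ) (η : ℂ), x ^ 2 + ‖η‖ ^ 2 = 1 ∧
      (α - z) * (x : ℂ) ^ 2 + (β - z) * (‖η‖ : ℂ) ^ 2 + s * (x * η) + ζ * (s * (x * conj η))
        = 0 := by
  obtain ⟨u₀, v₀, w₀, h₀, e1, e2⟩ := mem_discImage_iff.1 hz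
  obtain ⟨u, v, w, h, f1, f2⟩ := exists_mem_sphere_of_mem_ball h₀
    (p := ((α - β) / 2).re) (q := s / 2 * (1 + ζ.re)) (r := s / 2 * ζ.im)
    (p' := ((α - β) / 2).im) (q' := s / 2 * ζ.im) (r' := s / 2 * (1 - ζ.re))
  rw [e1] at f1
  rw [e2] at f2
  have hz' : z = (α + β) / 2 + (α - β) / 2 * u + s / 2 * ((⟨v, w⟩ : ℂ) + ζ * conj ⟨v, w⟩) := by
    rw [add_assoc, ← sub_eq_iff_eq_add', show (s : ℂ) / 2 = ((s / 2 : ℝ) : ℂ) by push_cast; rfl]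
    apply Complex.ext
    · rw [← f1]
      generalize (α - β) / 2 = h
      simp only [Complex.add_re, Complex.add_im, Complex.mul_re, Complex.mul_im, Complex.ofReal_re,
        Complex.ofReal_im, Complex.conj_re, Complex.conj_im]
      ring
    · rw [← f2]
      generalize (α - β) / 2 = h
      simp only [Complex.add_re, Complex.add_im, Complex.mul_re, Complex.mul_im, Complex.ofReal_re,
        Complex.ofReal_im, Complex.conj_re, Complex.conj_im]
      ring
  set τ : ℂ := ⟨v, w⟩ with hτ
  have hτn : ‖τ‖ ^ 2 = 1 - u ^ 2 := by
    rw [Complex.sq_norm, Complex.normSq_apply]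
    simp only [hτ]
    linarith
  -- Inverse of the Hopf map: a point `(u, τ)` of the sphere comes from a unit vector `(x, η)` whose
  -- first coordinate can be taken real and nonnegative. The pole `u = -1` is separate since `x = 0`
  -- there.
  obtain ⟨x, η, hx, hu, ht⟩ : ∃ (x : ℝ) (η : ℂ), x ^ 2 + ‖η‖ ^ 2 = 1 ∧ x ^ 2 - ‖η‖ ^ 2 = u ∧
      2 * (x * η) = τ := by
    by_cases hu : 1 + u = 0
    · refine ⟨0, 1, by simp, by simp; linarith, ?_⟩
      have : ‖τ‖ ^ 2 = 0 := by
        rw [hτn, show u = -1 by linarith]; norm_num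
      have : τ = 0 := by simpa using this
      simp [this]
    · have hu0 : 0 < (1 + u) / 2 := by
        have : 0 ≤ 1 + u := by nlinarith [sq_nonneg ‖τ‖, sq_nonneg (1 + u)]
        have : 0 < 1 + u := lt_of_le_of_ne this (Ne.symm hu)
        linarith
      have hx2 := Real.sq_sqrt hu0.le
      have hx0 : 0 < √((1 + u) / 2) := Real.sqrt_pos.2 hu0
      set x := √((1 + u) / 2) with hx
      have hx0' : (x : ℂ) ≠ 0 := by exact_mod_cast hx0.ne'
      have hη : ‖τ / (2 * x)‖ ^ 2 = (1 - u) / 2 := by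
        rw [norm_div, div_pow, hτn, norm_mul, Complex.norm_real, Real.norm_of_nonneg hx0.le,
          mul_pow, hx2, Complex.norm_ofNat]
        rw [div_eq_iff (by positivity)]
        ring
      refine ⟨x, τ / (2 * x), ?_, ?_, ?_⟩
      · rw [hη, hx2]; ring
      · rw [hη, hx2]; ring
      · field_simp
  refine ⟨x, η, hx, ?_⟩
  have hτ' : conj τ = 2 * (x * conj η) := by
    rw [← ht, map_mul, map_mul, Complex.conj_ofReal, map_ofNat]
  have hx' : (x : ℂ) ^ 2 + (‖η‖ : ℂ) ^ 2 = 1 := by exact_mod_cast hx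
  have hu' : (x : ℂ) ^ 2 - (‖η‖ : ℂ) ^ 2 = u := by exact_mod_cast hu
  rw [hτ', ← ht, ← hu'] at hz'
  linear_combination (-z + α / 2 + β / 2) * hx' - hz'

/-- By the parallelogram law, `(‖w - g‖ + ‖w + g‖)² = 2‖w‖² + 2‖g‖² + 2‖w² - g²‖`. Beyond `‖g‖`, the
foci enter only through `g²`, so no square root has to be expanded. -/
theorem norm_sub_add_norm_add_le_iff {w g : ℂ} {M K : ℝ} (hM : 0 ≤ M)
    (hK : M ^ 2 = 2 * K + 2 * ‖g‖ ^ 2) :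
    ‖w - g‖ + ‖w + g‖ ≤ M ↔ w.re ^ 2 + w.im ^ 2 ≤ K ∧
      (w.re ^ 2 - w.im ^ 2 - (g ^ 2).re) ^ 2 + (2 * w.re * w.im - (g ^ 2).im) ^ 2 ≤
        (K - (w.re ^ 2 + w.im ^ 2)) ^ 2 := by
  have hn : ∀ τ : ℂ, ‖τ‖ ^ 2 = τ.re ^ 2 + τ.im ^ 2 := fun τ => by
    rw [Complex.sq_norm, Complex.normSq_apply]; ring
  have h1 : (‖w - g‖ + ‖w + g‖) ^ 2 = 2 * (w.re ^ 2 + w.im ^ 2) + 2 * ‖g‖ ^ 2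
      + 2 * ‖w ^ 2 - g ^ 2‖ := by
    have : ‖w ^ 2 - g ^ 2‖ = ‖w - g‖ * ‖w + g‖ := by rw [← norm_mul]; congr 1; ring
    rw [this, hn g]
    calc _ = ‖w - g‖ ^ 2 + ‖w + g‖ ^ 2 + 2 * (‖w - g‖ * ‖w + g‖) := by ring
      _ = _ := by
        rw [hn, hn]
        simp only [Complex.sub_re, Complex.sub_im, Complex.add_re, Complex.add_im]
        ring
  have h2 : ‖w ^ 2 - g ^ 2‖ ^ 2 =
      (w.re ^ 2 - w.im ^ 2 - (g ^ 2).re) ^ 2 + (2 * w.re * w.im - (g ^ 2).im) ^ 2 := by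
    rw [hn, Complex.sub_re, Complex.sub_im]
    have e1 : (w ^ 2).re = w.re ^ 2 - w.im ^ 2 := by rw [sq, Complex.mul_re]; ring
    have e2 : (w ^ 2).im = 2 * w.re * w.im := by rw [sq, Complex.mul_im]; ring
    rw [e1, e2]
  rw [← h2, ← sq_le_sq₀ (by positivity) hM, h1, hK]
  constructor
  · intro h
    have h3 : ‖w ^ 2 - g ^ 2‖ ≤ K - (w.re ^ 2 + w.im ^ 2) := by linarith
    exact ⟨by linarith [norm_nonneg (w ^ 2 - g ^ 2)], pow_le_pow_left₀ (norm_nonneg _) h3 2⟩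
  · rintro ⟨h3, h4⟩
    have := le_of_sq_le_sq h4 (by linarith)
    linarith

/-- The elliptical range theorem for `!![α, s; ζ * s, β]`. -/
theorem isEllipticalDisc_discImage (α β ζ : ℂ) (s : ℝ) {δ : ℂ}
    (hδ : δ ^ 2 = (α - β) ^ 2 + 4 * ζ * (s : ℂ) ^ 2) :
    IsEllipticalDisc (discImage α β ζ s) ((α + β) / 2 + δ / 2) ((α + β) / 2 - δ / 2)
      (√(‖α - β‖ ^ 2 / 2 + (1 + ‖ζ‖ ^ 2) * s ^ 2 + ‖(α - β) ^ 2 + 4 * ζ * (s : ℂ) ^ 2‖ / 2))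
      (√(‖α - β‖ ^ 2 / 2 + (1 + ‖ζ‖ ^ 2) * s ^ 2
        - ‖(α - β) ^ 2 + 4 * ζ * (s : ℂ) ^ 2‖ / 2)) := by
  have hn : ∀ τ : ℂ, ‖τ‖ ^ 2 = τ.re ^ 2 + τ.im ^ 2 := fun τ => by
    rw [Complex.sq_norm, Complex.normSq_apply]; ring
  have hD : ‖(α - β) ^ 2 + 4 * ζ * (s : ℂ) ^ 2‖ = ‖δ‖ ^ 2 := by rw [← hδ, norm_pow]
  have hle : ‖(α - β) ^ 2 + 4 * ζ * (s : ℂ) ^ 2‖ ≤ ‖α - β‖ ^ 2 + 4 * ‖ζ‖ * s ^ 2 := by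
    refine (norm_add_le _ _).trans_eq ?_
    simp [norm_pow, sq_abs]
  rw [hD] at hle ⊢
  have hpos : 0 ≤ ‖α - β‖ ^ 2 / 2 + (1 + ‖ζ‖ ^ 2) * s ^ 2 - ‖δ‖ ^ 2 / 2 := by
    -- With the triangle inequality `hle`, twice the radicand of the minor axis is at least `2(1 -
    -- ‖ζ‖)²s²`.
    have : 0 ≤ (1 - ‖ζ‖) ^ 2 * s ^ 2 := by positivity
    nlinarith
  have hpos' : 0 ≤ ‖α - β‖ ^ 2 / 2 + (1 + ‖ζ‖ ^ 2) * s ^ 2 + ‖δ‖ ^ 2 / 2 := by positivity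
  refine ⟨Real.sqrt_nonneg _, Real.sqrt_nonneg _, ?_, ?_⟩
  · rw [Real.sq_sqrt hpos, Real.sq_sqrt hpos']
    have : (α + β) / 2 + δ / 2 - ((α + β) / 2 - δ / 2) = δ := by ring
    rw [this]
    ring
  · ext z
    set h := (α - β) / 2 with hh
    set g := δ / 2 with hg
    have hg2 : g ^ 2 = h ^ 2 + ζ * (s : ℂ) ^ 2 := by
      rw [hg, hh, div_pow, hδ]; ring
    have hαβ : ‖α - β‖ ^ 2 = 4 * ‖h‖ ^ 2 := by
      rw [hh, norm_div, div_pow, Complex.norm_ofNat]; ring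
    have hδg : ‖δ‖ ^ 2 = 4 * ‖g‖ ^ 2 := by
      rw [hg, norm_div, div_pow, Complex.norm_ofNat]; ring
    have e1 : (g ^ 2).re = h.re ^ 2 - h.im ^ 2 + ζ.re * s ^ 2 := by
      rw [hg2, ← Complex.ofReal_pow, Complex.add_re, sq, Complex.mul_re, Complex.re_mul_ofReal]
      ring
    have e2 : (g ^ 2).im = 2 * h.re * h.im + ζ.im * s ^ 2 := by
      rw [hg2, ← Complex.ofReal_pow, Complex.add_im, sq, Complex.mul_im, Complex.im_mul_ofReal]
      ring
    have hw1 : z - ((α + β) / 2 + g) = z - (α + β) / 2 - g := by ring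
    have hw2 : z - ((α + β) / 2 - g) = z - (α + β) / 2 + g := by ring
    rw [Set.mem_ofPred_eq, hw1, hw2, norm_sub_add_norm_add_le_iff (Real.sqrt_nonneg _)
      (K := h.re ^ 2 + h.im ^ 2 + (1 + (ζ.re ^ 2 + ζ.im ^ 2)) * s ^ 2 / 2)
      (by rw [Real.sq_sqrt hpos', hαβ, hδg, hn h, hn ζ]; ring), mem_discImage_iff, e1, e2]
    generalize z - (α + β) / 2 = w
    constructor
    · rintro ⟨u, v, w', hb, h1, h2⟩
      obtain ⟨g1, g2⟩ := gram_of_mem_ball hb (p := h.re) (q := s / 2 * (1 + ζ.re))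
        (r := s / 2 * ζ.im) (p' := h.im) (q' := s / 2 * ζ.im) (r' := s / 2 * (1 - ζ.re))
      rw [h1, h2] at g1 g2
      exact ⟨by linarith, by linarith⟩
    · rintro ⟨h1, h2⟩
      exact exists_mem_ball_of_gram (by linarith) (by linarith)

end EllipticalDisc

/-! ### The parity block form and its isotropic subspaces. -/

section BlockForm

/-- The vertices of a path, split by parity. -/
def parityEquiv (n : ℕ) : Fin ((n + 1) / 2) ⊕ Fin (n / 2) ≃ Fin n where
  toFun := Sum.elim (fun i => ⟨2 * i, by omega⟩) (fun j => ⟨2 * j + 1, by omega⟩)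
  invFun i := if h : (i : ℕ) % 2 = 0 then Sum.inl ⟨i / 2, by omega⟩ else Sum.inr ⟨i / 2, by omega⟩
  left_inv := by
    rintro (i | j)
    · simp
    · have : (2 * (j : ℕ) + 1) / 2 = j := by omega
      simp [this]
  right_inv i := by
    by_cases h : (i : ℕ) % 2 = 0
    · simp only [h, dif_pos, Sum.elim_inl]
      ext
      simp
      omega
    · simp only [h, dif_neg, not_false_iff, Sum.elim_inr]
      ext
      simp
      omega

/-- An edge of odd index starts at an odd vertex, so its superdiagonal entry lands in the lower left
block. Putting `ζ` there for exactly these edges collects all factors `ζ` in one block. -/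
theorem mixedTridiagonal_submatrix_parityEquiv {n : ℕ} (ζ a b : ℂ) (c : Fin (n - 1) → ℂ) :
    (mixedTridiagonal ζ (biperiodic a b) c {j | Odd (j : ℕ)}).submatrix
      (parityEquiv n) (parityEquiv n) =
    fromBlocks (a • 1) (bidiagonal c) (ζ • (bidiagonal c)ᴴ) (b • 1) := by
  ext (i | i) (j | j)
  · simp only [submatrix_apply, fromBlocks_apply₁₁, mixedTridiagonal, parityEquiv, Equiv.coe_fn_mk,
      Sum.elim_inl, Matrix.smul_apply, one_apply]
    by_cases h : i = j
    · subst h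
      rw [tridiagonal_apply_self]
      simp [biperiodic]
    · have h' : (i : ℕ) ≠ j := fun h' => h (Fin.ext h')
      rw [tridiagonal_apply_of_ne]
      · simp [h]
      · simp [h']
      · simp; omega
      · simp; omega
  · simp only [submatrix_apply, fromBlocks_apply₁₂, mixedTridiagonal, parityEquiv, Equiv.coe_fn_mk,
      Sum.elim_inl, Sum.elim_inr, bidiagonal, of_apply]
    by_cases h : (i : ℕ) = j
    · rw [tridiagonal_apply_succ _ _ _ (by simp [h])]
      simp [h]
    by_cases h1 : (i : ℕ) = j + 1
    · rw [tridiagonal_succ_apply _ _ _ (by simp; omega)]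
      simp [h1]
    · rw [tridiagonal_apply_of_ne]
      · simp [h, h1]
      · simp; omega
      · simp; omega
      · simp; omega
  · simp only [submatrix_apply, fromBlocks_apply₂₁, mixedTridiagonal, parityEquiv, Equiv.coe_fn_mk,
      Sum.elim_inl, Sum.elim_inr, bidiagonal, of_apply, Matrix.smul_apply, conjTranspose_apply]
    by_cases h : (j : ℕ) = i
    · rw [tridiagonal_succ_apply _ _ _ (by simp [h])]
      simp [h]
    by_cases h1 : (j : ℕ) = i + 1
    · rw [tridiagonal_apply_succ _ _ _ (by simp; omega)]
      simp [h1]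
    · rw [tridiagonal_apply_of_ne]
      · simp [h, h1]
      · simp; omega
      · simp; omega
      · simp; omega
  · simp only [submatrix_apply, fromBlocks_apply₂₂, mixedTridiagonal, parityEquiv, Equiv.coe_fn_mk,
      Sum.elim_inr, Matrix.smul_apply, one_apply]
    by_cases h : i = j
    · subst h
      rw [tridiagonal_apply_self]
      simp [biperiodic]
    · have h' : (i : ℕ) ≠ j := fun h' => h (Fin.ext h')
      rw [tridiagonal_apply_of_ne]
      · simp [h]
      · simp [h']
      · simp; omega
      · simp; omega

theorem starCongruent_rectDiagonal {m n : ℕ} (hmn : n ≤ m) (a b ζ : ℂ)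
    (B : Matrix (Fin m) (Fin n) ℂ) :
    StarCongruent (fromBlocks (a • 1) B (ζ • Bᴴ) (b • 1))
      (fromBlocks (a • 1) (rectDiagonal m n fun j => (singularValue B (j + 1) : ℂ))
        (ζ • (rectDiagonal m n fun j => (singularValue B (j + 1) : ℂ))ᴴ) (b • 1)) := by
  obtain ⟨F, G, hF, hG, h⟩ := exists_singular_value_decomposition hmn B
  refine ⟨fromBlocks F 0 0 G, ?_, ?_⟩
  · refine IsUnit.of_mul_eq_one_right (fromBlocks Fᴴ 0 0 Gᴴ) ?_
    rw [fromBlocks_multiply]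
    simp [hF, hG]
  · rw [fromBlocks_conjTranspose, fromBlocks_multiply, fromBlocks_multiply, ← h]
    simp [hF, hG, Matrix.mul_assoc]

/-- Here `U` and `W` stand for the squared norms of the two components of an isotropic vector and
`t` for their pairing. Dividing by `U + W` normalizes the vector, and the bound on `t` puts the
resulting point into the unit ball. -/
theorem mem_discImage_of_form_eq_zero {α β ζ z t : ℂ} {s U W : ℝ} (hU : 0 ≤ U) (hW : 0 ≤ W)
    (hN : 0 < U + W) (ht : ‖t‖ ^ 2 ≤ s ^ 2 * (U * W))
    (h : (α - z) * U + (β - z) * W + t + ζ * conj t = 0) : z ∈ discImage α β ζ s := by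
  have hN' : (U : ℂ) + W ≠ 0 := by exact_mod_cast hN.ne'
  refine ⟨(U - W) / (U + W), 2 * t / (s * (U + W)), ?_, ?_⟩
  · have hs : ‖2 * t / (s * (U + W))‖ ^ 2 ≤ 4 * (U * W) / (U + W) ^ 2 := by
      by_cases hs : s = 0
      · have : 0 ≤ 4 * (U * W) / (U + W) ^ 2 := by positivity
        simpa [hs] using this
      · have hs2 : 0 < s ^ 2 := by positivity
        have : ‖(s : ℂ) * (U + W)‖ ^ 2 = s ^ 2 * (U + W) ^ 2 := by
          rw [← Complex.ofReal_add, ← Complex.ofReal_mul, Complex.norm_real, Real.norm_eq_abs,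
            sq_abs]
          ring
        rw [norm_div, div_pow, this, norm_mul, Complex.norm_ofNat,
          div_le_div_iff₀ (by positivity) (by positivity)]
        calc (2 * ‖t‖) ^ 2 * (U + W) ^ 2 = 4 * ‖t‖ ^ 2 * (U + W) ^ 2 := by ring
          _ ≤ 4 * (s ^ 2 * (U * W)) * (U + W) ^ 2 := by gcongr
          _ = _ := by ring
    calc _ ≤ ((U - W) / (U + W)) ^ 2 + 4 * (U * W) / (U + W) ^ 2 := by gcongr
      _ = 1 := by field_simp; ring
  · have ht' : (s : ℂ) / 2 * (2 * t / (s * (U + W)) + ζ * conj (2 * t / (s * (U + W)))) =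
        (t + ζ * conj t) / (U + W) := by
      simp only [map_div₀, map_mul, map_add, Complex.conj_ofReal, map_ofNat]
      -- For `s = 0` the quotient defining `τ` is `0` by convention, which is harmless because `t =
      -- 0` as well.
      by_cases hs : s = 0
      · have : t = 0 := by
          rw [hs] at ht
          have : ‖t‖ ^ 2 = 0 := le_antisymm (by simpa using ht) (by positivity)
          simpa using this
        simp [this]
      · have hs' : (s : ℂ) ≠ 0 := by exact_mod_cast hs
        field_simp
    rw [ht']
    push_cast
    field_simp
    linear_combination (-2) * h

theorem star_dotProduct_self_eq {l : Type*} [Fintype l] (u : l → ℂ) :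
    star u ⬝ᵥ u = (∑ i, ‖u i‖ ^ 2 : ℝ) := by
  simp [dotProduct, Complex.conj_mul']

theorem dotProduct_fromBlocks_mulVec {m n : Type*} [Fintype m] [Fintype n] [DecidableEq m]
    [DecidableEq n] (a b ζ : ℂ) (B : Matrix m n ℂ) (v : m ⊕ n → ℂ) :
    star v ⬝ᵥ fromBlocks (a • 1) B (ζ • Bᴴ) (b • 1) *ᵥ v =
      a * (∑ i, ‖v (Sum.inl i)‖ ^ 2 : ℝ) + b * (∑ j, ‖v (Sum.inr j)‖ ^ 2 : ℝ)
        + star (v ∘ Sum.inl) ⬝ᵥ B *ᵥ (v ∘ Sum.inr)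
        + ζ * conj (star (v ∘ Sum.inl) ⬝ᵥ B *ᵥ (v ∘ Sum.inr)) := by
  have hc : conj (star (v ∘ Sum.inl) ⬝ᵥ B *ᵥ (v ∘ Sum.inr)) =
      star (v ∘ Sum.inr) ⬝ᵥ Bᴴ *ᵥ (v ∘ Sum.inl) := by
    change star _ = _
    rw [star_dotProduct, star_star, dotProduct_comm, star_mulVec, dotProduct_mulVec,
      dotProduct_comm, dotProduct_comm _ (v ∘ Sum.inl)]
  have hsv : star v = Sum.elim (star (v ∘ Sum.inl)) (star (v ∘ Sum.inr)) := by
    ext (i | i) <;> rfl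
  rw [hc, hsv, fromBlocks_mulVec, sumElim_dotProduct_sumElim]
  simp only [smul_mulVec, one_mulVec, dotProduct_add, dotProduct_smul, smul_eq_mul,
    star_dotProduct_self_eq, Function.comp_apply]
  ring

theorem hasIsotropicFrame_rectDiagonal_iff {m n k : ℕ} (hmn : n ≤ m) (hk : 1 ≤ k) (hkn : k ≤ n)
    {σ : ℕ → ℝ} (hσ : Antitone σ) (hσ0 : ∀ j, 0 ≤ σ j) (α β ζ z : ℂ) :
    HasIsotropicFrame (fromBlocks ((α - z) • 1) (rectDiagonal m n fun j => (σ j : ℂ))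
      (ζ • (rectDiagonal m n fun j => (σ j : ℂ))ᴴ) ((β - z) • 1)) k ↔
    z ∈ discImage α β ζ (σ (k - 1)) := by
  constructor
  · intro h
    -- Killing the `k - 1` coordinates of the second component that carry the largest singular
    -- values leaves a nonzero isotropic vector on which the off-diagonal block has norm at most `σ
    -- (k - 1)`.
    let K : Finset (Fin m ⊕ Fin n) :=
      Finset.univ.map ((Fin.castLEEmb (show k - 1 ≤ n by omega)).trans Function.Embedding.inr)
    obtain ⟨v, hv0, hvK, hv⟩ := h.exists_vector K (by simp [K]; omega)
    rw [dotProduct_fromBlocks_mulVec] at hv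
    have hvK' : ∀ j : Fin n, (j : ℕ) < k - 1 → v (Sum.inr j) = 0 := fun j hj =>
      hvK _ (by simp only [K, Finset.mem_map]; exact ⟨⟨j, hj⟩, Finset.mem_univ _, rfl⟩)
    refine mem_discImage_of_form_eq_zero (Finset.sum_nonneg fun i _ => sq_nonneg _)
      (Finset.sum_nonneg fun i _ => sq_nonneg _) ?_ ?_ hv
    · refine lt_of_le_of_ne (by positivity) fun h0 => hv0 ?_
      have h1 : ∑ i, ‖v (Sum.inl i)‖ ^ 2 = 0 ∧ ∑ j, ‖v (Sum.inr j)‖ ^ 2 = 0 :=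
        (add_eq_zero_iff_of_nonneg (by positivity) (by positivity)).1 h0.symm
      rw [Finset.sum_eq_zero_iff_of_nonneg fun i _ => sq_nonneg _,
        Finset.sum_eq_zero_iff_of_nonneg fun i _ => sq_nonneg _] at h1
      ext (i | j)
      · simpa using h1.1 i (Finset.mem_univ _)
      · simpa using h1.2 j (Finset.mem_univ _)
    · set D := rectDiagonal m n fun j => (σ j : ℂ) with hD
      set u := v ∘ Sum.inl with hu
      set w := v ∘ Sum.inr with hw
      have h1 : star u ⬝ᵥ D *ᵥ w = inner ℂ (WithLp.toLp 2 u) (WithLp.toLp 2 (D *ᵥ w)) := by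
        rw [EuclideanSpace.inner_eq_star_dotProduct, dotProduct_comm]
      have h2 : ‖(WithLp.toLp 2 (D *ᵥ w) : EuclideanSpace ℂ (Fin m))‖ ^ 2 ≤
          σ (k - 1) ^ 2 * ∑ j, ‖w j‖ ^ 2 := by
        have h3 : ((‖(WithLp.toLp 2 (D *ᵥ w) : EuclideanSpace ℂ (Fin m))‖ ^ 2 : ℝ) : ℂ) =
            ((∑ j : Fin n, σ j ^ 2 * ‖w j‖ ^ 2 : ℝ) : ℂ) := by
          have h4 : star (D *ᵥ w) ⬝ᵥ (D *ᵥ w) =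
              ((‖(WithLp.toLp 2 (D *ᵥ w) : EuclideanSpace ℂ (Fin m))‖ ^ 2 : ℝ) : ℂ) := by
            have := inner_self_eq_norm_sq_to_K (𝕜 := ℂ)
              (WithLp.toLp 2 (D *ᵥ w) : EuclideanSpace ℂ (Fin m))
            rw [EuclideanSpace.inner_eq_star_dotProduct, dotProduct_comm] at this
            push_cast
            exact this
          rw [← h4, star_mulVec, ← dotProduct_mulVec, mulVec_mulVec, hD,
            rectDiagonal_conjTranspose_mul hmn, dotProduct]
          push_cast
          refine Finset.sum_congr rfl fun j _ => ?_
          rw [rectDiagonal_mulVec_apply _ _ rfl, Pi.star_apply, Complex.conj_ofReal]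
          have := Complex.conj_mul' (w j)
          change conj (w j) * _ = _
          linear_combination (σ j : ℂ) ^ 2 * this
        rw [Complex.ofReal_inj.1 h3, Finset.mul_sum]
        refine Finset.sum_le_sum fun j _ => ?_
        by_cases hj : (j : ℕ) < k - 1
        · simp [hw, hvK' j hj]
        · have := hσ (not_lt.1 hj)
          have := hσ0 j
          gcongr
      calc ‖star u ⬝ᵥ D *ᵥ w‖ ^ 2 ≤ (‖(WithLp.toLp 2 u : EuclideanSpace ℂ (Fin m))‖ *
            ‖(WithLp.toLp 2 (D *ᵥ w) : EuclideanSpace ℂ (Fin m))‖) ^ 2 := by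
            rw [h1]; gcongr; exact norm_inner_le_norm _ _
        _ = (∑ i, ‖u i‖ ^ 2) * ‖(WithLp.toLp 2 (D *ᵥ w) : EuclideanSpace ℂ (Fin m))‖ ^ 2 := by
            rw [mul_pow, EuclideanSpace.norm_sq_eq]
        _ ≤ (∑ i, ‖u i‖ ^ 2) * (σ (k - 1) ^ 2 * ∑ j, ‖w j‖ ^ 2) := by gcongr
        _ = _ := by simp only [hu, hw, Function.comp_apply]; ring
  · intro hz
    -- The discs grow with `s`, so `z` lies in the disc of each of the first `k` blocks. For `l ≥ k`
    -- the values are irrelevant and only make the sequences total.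
    have hex : ∀ l : ℕ, ∃ (x : ℝ) (η : ℂ), l < k → x ^ 2 + ‖η‖ ^ 2 = 1 ∧
        (α - z) * (x : ℂ) ^ 2 + (β - z) * (‖η‖ : ℂ) ^ 2 + σ l * (x * η)
          + ζ * (σ l * (x * conj η)) = 0 := by
      intro l
      by_cases hl : l < k
      · obtain ⟨x, η, h⟩ := exists_unit_vector_of_mem_discImage
          (discImage_mono α β ζ (hσ0 _) (hσ (show l ≤ k - 1 by omega)) hz)
        exact ⟨x, η, fun _ => h⟩
      · exact ⟨0, 0, fun h => absurd h hl⟩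
    choose x η hx using hex
    refine ⟨fromRows (rectDiagonal m k fun l => (x l : ℂ)) (rectDiagonal n k η), ?_, ?_⟩
    · intro y hy
      rw [fromRows_mulVec] at hy
      ext l
      have h1 := congrFun hy (Sum.inl (Fin.castLE (hkn.trans hmn) l))
      have h2 := congrFun hy (Sum.inr (Fin.castLE hkn l))
      rw [Sum.elim_inl, rectDiagonal_mulVec_apply (j := l) _ _ (Fin.val_castLE _ _)] at h1
      rw [Sum.elim_inr, rectDiagonal_mulVec_apply (j := l) _ _ (Fin.val_castLE _ _)] at h2
      rcases mul_eq_zero.1 h1 with h3 | h3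
      · rcases mul_eq_zero.1 h2 with h4 | h4
        · have := (hx l l.2).1
          rw [h4, Complex.ofReal_eq_zero.1 h3] at this
          simp at this
        · exact h4
      · exact h3
    · rw [conjTranspose_fromRows_eq_fromCols_conjTranspose, Matrix.mul_assoc,
        fromBlocks_mul_fromRows, fromCols_mul_fromRows]
      simp only [Matrix.smul_mul, Matrix.one_mul, Matrix.mul_add, Matrix.mul_smul]
      rw [rectDiagonal_mul hkn, rectDiagonal_conjTranspose_mul (hkn.trans hmn),
        rectDiagonal_conjTranspose_mul (hkn.trans hmn),
        rectDiagonal_conjTranspose_mul (hkn.trans hmn), rectDiagonal_conjTranspose_mul hkn,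
        rectDiagonal_conjTranspose_mul hkn]
      ext i j
      simp only [rectDiagonal, Matrix.add_apply, Matrix.smul_apply, of_apply, Matrix.zero_apply]
      split_ifs
      · have := (hx j j.2).2
        have h2 := Complex.conj_mul' (η j)
        simp only [Complex.conj_ofReal, smul_eq_mul]
        linear_combination this + (β - z) * h2
      · simp

end BlockForm

/-! ### Independent sets and kernels on a path. -/

section PathKernel

/-- On a path with edges `j — j + 1` for `e j`, there are an independent set `I` and a set `U` of
`2 * |I| - n` vertices such that a null vector of a weighted adjacency matrix that vanishes
on `U` is zero. -/
theorem exists_independent_set_path (n : ℕ) : ∀ e : ℕ → Prop, (∀ j, e j → j + 1 < n) →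
    ∃ I U : Finset ℕ, I ⊆ Finset.range n ∧ (∀ i ∈ I, i + 1 ∈ I → ¬ e i) ∧
      2 * I.card = n + U.card ∧ ∀ c d x : ℕ → ℂ, (∀ j, c j ≠ 0 ↔ e j) → (∀ j, d j ≠ 0 ↔ e j) →
        c 0 * x 1 = 0 → (∀ i, i + 1 < n → d i * x i + c (i + 1) * x (i + 2) = 0) →
        (∀ i ∈ U, x i = 0) → ∀ i < n, x i = 0 := by
  induction n using Nat.strong_induction_on with
  | _ n ih =>
    intro e he
    rcases Nat.eq_zero_or_pos n with rfl | hn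
    · exact ⟨∅, ∅, by simp, by simp, by simp, by simp⟩
    by_cases h0 : e 0
    · have hn2 := he 0 h0
      -- Greedy choice: the end vertex `0` goes into `I`, and both ends of its edge are removed. Row
      -- `0` gives `x 1 = 0`, and row `1` gives `x 0 = 0` once the tail vanishes.
      obtain ⟨I, U, hI, hind, hcard, hker⟩ := ih (n - 2) (by omega) (fun j => e (j + 2))
        (fun j hj => by have := he _ hj; omega)
      let f : ℕ ↪ ℕ := addRightEmbedding 2
      refine ⟨insert 0 (I.map f), U.map f, ?_, ?_, ?_, ?_⟩
      · intro i hi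
        rw [Finset.mem_insert, Finset.mem_map] at hi
        rcases hi with rfl | ⟨j, hj, rfl⟩
        · simpa using hn
        · have := Finset.mem_range.1 (hI hj)
          simp only [f, addRightEmbedding_apply, Finset.mem_range]
          omega
      · intro i hi hi'
        simp only [Finset.mem_insert, Finset.mem_map, f, addRightEmbedding_apply] at hi hi'
        rcases hi with rfl | ⟨j, hj, rfl⟩
        · rcases hi' with h | ⟨l, _, h⟩ <;> omega
        · rcases hi' with h | ⟨l, hl, h⟩
          · omega
          · obtain rfl : l = j + 1 := by omega
            exact hind j hj hl
      · rw [Finset.card_insert_of_notMem (by simp [f]), Finset.card_map, Finset.card_map]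
        omega
      · intro c d x hc hd hx0 hx hU
        have hx1 : x 1 = 0 := (mul_eq_zero.1 hx0).resolve_left ((hc 0).2 h0)
        have htail : ∀ i < n - 2, x (i + 2) = 0 := by
          refine hker (fun j => c (j + 2)) (fun j => d (j + 2)) (fun j => x (j + 2))
            (fun j => hc _) (fun j => hd _) ?_ (fun i hi => hx (i + 2) (by omega))
            (fun i hi => hU _ (Finset.mem_map_of_mem f hi))
          by_cases h2 : e 2
          · have := hx 1 (by have := he 2 h2; omega)
            simpa [hx1] using this
          · have : c 2 = 0 := not_not.1 fun h => h2 ((hc 2).1 h)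
            simp [this]
        have hx2 : c 1 * x 2 = 0 := by
          by_cases h1 : e 1
          · have := he 1 h1
            rw [show x 2 = 0 from htail 0 (by omega), mul_zero]
          · have : c 1 = 0 := not_not.1 fun h => h1 ((hc 1).1 h)
            simp [this]
        intro i hi
        match i with
        | 0 =>
          have := hx 0 (by omega)
          rw [zero_add, hx2, add_zero] at this
          exact (mul_eq_zero.1 this).resolve_left ((hd 0).2 h0)
        | 1 => exact hx1
        | i + 2 => exact htail i (by omega)
    -- An isolated end vertex goes into `I` and also into `U`, since no equation constrains `x 0`.
    · obtain ⟨I, U, hI, hind, hcard, hker⟩ := ih (n - 1) (by omega) (fun j => e (j + 1))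
        (fun j hj => by have := he _ hj; omega)
      let f : ℕ ↪ ℕ := addRightEmbedding 1
      refine ⟨insert 0 (I.map f), insert 0 (U.map f), ?_, ?_, ?_, ?_⟩
      · intro i hi
        rw [Finset.mem_insert, Finset.mem_map] at hi
        rcases hi with rfl | ⟨j, hj, rfl⟩
        · simpa using hn
        · have := Finset.mem_range.1 (hI hj)
          simp only [f, addRightEmbedding_apply, Finset.mem_range]
          omega
      · intro i hi hi'
        simp only [Finset.mem_insert, Finset.mem_map, f, addRightEmbedding_apply] at hi hi'
        rcases hi with rfl | ⟨j, hj, rfl⟩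
        · exact h0
        · rcases hi' with h | ⟨l, hl, h⟩
          · omega
          · obtain rfl : l = j + 1 := by omega
            exact hind j hj hl
      · rw [Finset.card_insert_of_notMem (by simp [f]), Finset.card_insert_of_notMem (by simp [f]),
          Finset.card_map, Finset.card_map]
        omega
      · intro c d x hc hd hx0 hx hU
        have hz : x 0 = 0 := hU 0 (Finset.mem_insert_self _ _)
        have htail : ∀ i < n - 1, x (i + 1) = 0 := by
          refine hker (fun j => c (j + 1)) (fun j => d (j + 1)) (fun j => x (j + 1))
            (fun j => hc _) (fun j => hd _) ?_ (fun i hi => hx (i + 1) (by omega))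
            (fun i hi => hU _ (Finset.mem_insert_of_mem (Finset.mem_map_of_mem f hi)))
          by_cases h1 : e 1
          · have := hx 0 (by have := he 1 h1; omega)
            simpa [hz] using this
          · have : c 1 = 0 := not_not.1 fun h => h1 ((hc 1).1 h)
            simp [this]
        intro i hi
        match i with
        | 0 => exact hz
        | i + 1 => exact htail i (by omega)

/-- Extension of a finite sequence by zeros. -/
def extendZero {m : ℕ} (c : Fin m → ℂ) (j : ℕ) : ℂ := if h : j < m then c ⟨j, h⟩ else 0

theorem tridiagonal_zero_mulVec {n : ℕ} (d c : Fin (n - 1) → ℂ) (x : Fin n → ℂ) (i : Fin n) :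
    (tridiagonal d 0 c *ᵥ x) i = extendZero c i * extendZero x (i + 1) +
      ∑ j ∈ Finset.range n, if j + 1 = i then extendZero d j * extendZero x j else 0 := by
  have hT : ∀ j : Fin n, tridiagonal d 0 c i j * x j =
      (if (i : ℕ) + 1 = j then extendZero c i * extendZero x j else 0) +
        if (j : ℕ) + 1 = i then extendZero d j * extendZero x j else 0 := by
    intro j
    have hx : extendZero x j = x j := by simp [extendZero]
    rw [hx]
    by_cases h1 : (i : ℕ) + 1 = j
    · have h2 : ¬ (j : ℕ) + 1 = i := by omega
      have h3 : (i : ℕ) < n - 1 := by omega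
      rw [tridiagonal_apply_succ _ _ _ h1]
      simp [h1, h2, extendZero, h3]
    by_cases h2 : (j : ℕ) + 1 = i
    · have h3 : (j : ℕ) < n - 1 := by omega
      rw [tridiagonal_succ_apply _ _ _ h2]
      simp [h1, h2, extendZero, h3]
    · by_cases h : i = j
      · subst h
        rw [tridiagonal_apply_self]
        simp
      · rw [tridiagonal_apply_of_ne _ _ _ h h1 h2]
        simp [h1, h2]
  rw [mulVec, dotProduct, Finset.sum_congr rfl fun j _ => hT j, Finset.sum_add_distrib,
    Fin.sum_univ_eq_sum_range
      (fun j => if (i : ℕ) + 1 = j then extendZero c i * extendZero x j else 0),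
    Fin.sum_univ_eq_sum_range (fun j => if j + 1 = (i : ℕ) then extendZero d j * extendZero x j
      else 0), Finset.sum_ite_eq]
  congr 1
  split_ifs with h
  · rfl
  · have : ¬ (i : ℕ) + 1 < n := fun h' => h (Finset.mem_range.2 h')
    simp [extendZero, this]

/-- `I` and `u` depend only on the support of `w`, so the same kernel bound serves all tridiagonal
matrices with that support and zero diagonal. -/
theorem exists_independent_set_tridiagonal {n : ℕ} (w : Fin (n - 1) → ℂ) :
    ∃ (I : Finset (Fin n)) (u : ℕ), 2 * I.card = n + u ∧
      (∀ i ∈ I, ∀ j ∈ I, ∀ h : (i : ℕ) + 1 = j, w ⟨i, by omega⟩ = 0) ∧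
      ∀ c d : Fin (n - 1) → ℂ, (∀ j, c j = 0 ↔ w j = 0) → (∀ j, d j = 0 ↔ w j = 0) →
        Module.finrank ℂ (LinearMap.ker (tridiagonal d 0 c).mulVecLin) ≤ u := by
  obtain ⟨I, U, hI, hind, hcard, hker⟩ := exists_independent_set_path n
    (fun j => ∃ h : j < n - 1, w ⟨j, h⟩ ≠ 0) (fun j ⟨h, _⟩ => by omega)
  refine ⟨I.attachFin fun i hi => Finset.mem_range.1 (hI hi), U.card, ?_, ?_, ?_⟩
  · rw [Finset.card_attachFin, hcard]
  · intro i hi j hj h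
    rw [Finset.mem_attachFin] at hi hj
    rw [← h] at hj
    by_contra h0
    exact hind i hi hj ⟨by omega, h0⟩
  · intro c d hc hd
    have hext : ∀ c : Fin (n - 1) → ℂ, (∀ j, c j = 0 ↔ w j = 0) →
        ∀ j, extendZero c j ≠ 0 ↔ ∃ h : j < n - 1, w ⟨j, h⟩ ≠ 0 := by
      intro c hc j
      by_cases h : j < n - 1 <;> simp [extendZero, h, hc]
    let g : LinearMap.ker (tridiagonal d 0 c).mulVecLin →ₗ[ℂ] (U → ℂ) :=
      { toFun := fun x i => extendZero x.1 i
        map_add' := by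
          intro x y
          ext i
          simp only [extendZero, Pi.add_apply, Submodule.coe_add]
          split_ifs <;> simp
        map_smul' := by
          intro a x
          ext i
          simp only [extendZero, Pi.smul_apply, Submodule.coe_smul, RingHom.id_apply, smul_eq_mul]
          split_ifs <;> simp }
    have hg : Function.Injective g := by
      rw [← LinearMap.ker_eq_bot, LinearMap.ker_eq_bot']
      rintro ⟨x, hx⟩ h
      have hx' : ∀ i : Fin n, (tridiagonal d 0 c *ᵥ x) i = 0 := congrFun (LinearMap.mem_ker.1 hx)
      simp only [tridiagonal_zero_mulVec] at hx'
      have key := hker (extendZero c) (extendZero d) (extendZero x) (hext c hc) (hext d hd) ?_ ?_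
        (fun i hi => congrFun h ⟨i, hi⟩)
      · refine Subtype.ext (funext fun i => ?_)
        have := key i i.2
        simpa [extendZero] using this
      · rcases Nat.eq_zero_or_pos n with rfl | hn
        · simp [extendZero]
        · simpa using hx' ⟨0, hn⟩
      · intro i hi
        have := hx' ⟨i + 1, hi⟩
        simp only [Nat.add_right_cancel_iff, Finset.sum_ite_eq'] at this
        rw [if_pos (Finset.mem_range.2 (by omega))] at this
        rw [add_comm]
        exact this
    have := LinearMap.finrank_le_finrank_of_injective hg
    simpa using this

theorem finrank_ker_fromBlocks_zero {m n : Type*} [Fintype m] [Fintype n] (B : Matrix m n ℂ)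
    (C : Matrix n m ℂ) :
    Module.finrank ℂ (LinearMap.ker (fromBlocks 0 B C 0).mulVecLin) + (B.rank + C.rank) =
      Fintype.card m + Fintype.card n := by
  let g : LinearMap.ker (fromBlocks 0 B C 0).mulVecLin ≃ₗ[ℂ]
      (LinearMap.ker B.mulVecLin × LinearMap.ker C.mulVecLin) :=
    { toFun := fun x =>
        (⟨x.1 ∘ Sum.inr, by
          have := LinearMap.mem_ker.1 x.2
          rw [mulVecLin_apply, fromBlocks_mulVec] at this
          ext i
          simpa using congrFun this (Sum.inl i)⟩,
        ⟨x.1 ∘ Sum.inl, by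
          have := LinearMap.mem_ker.1 x.2
          rw [mulVecLin_apply, fromBlocks_mulVec] at this
          ext i
          simpa using congrFun this (Sum.inr i)⟩)
      invFun := fun y => ⟨Sum.elim y.2.1 y.1.1, by
        have h1 := LinearMap.mem_ker.1 y.1.2
        have h2 := LinearMap.mem_ker.1 y.2.2
        rw [mulVecLin_apply] at h1 h2
        rw [LinearMap.mem_ker, mulVecLin_apply, fromBlocks_mulVec]
        ext (i | i) <;> simp [Sum.elim_comp_inl, Sum.elim_comp_inr, h1, h2]⟩
      left_inv := fun x => Subtype.ext (Sum.elim_comp_inl_inr x.1)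
      right_inv := fun y => rfl
      map_add' := fun x y => rfl
      map_smul' := fun a x => rfl }
  rw [g.finrank_eq, Module.finrank_prod]
  have h1 := LinearMap.finrank_range_add_finrank_ker B.mulVecLin
  have h2 := LinearMap.finrank_range_add_finrank_ker C.mulVecLin
  rw [Module.finrank_fintype_fun_eq_card] at h1 h2
  change B.rank + _ = _ at h1
  change C.rank + _ = _ at h2
  omega

theorem finrank_ker_submatrix {m n : Type*} [Fintype m] [Fintype n] [DecidableEq m]
    [DecidableEq n] (A : Matrix m m ℂ) (e : n ≃ m) :
    Module.finrank ℂ (LinearMap.ker (A.submatrix e e).mulVecLin) =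
      Module.finrank ℂ (LinearMap.ker A.mulVecLin) := by
  have h1 := LinearMap.finrank_range_add_finrank_ker A.mulVecLin
  have h2 := LinearMap.finrank_range_add_finrank_ker (A.submatrix e e).mulVecLin
  rw [Module.finrank_fintype_fun_eq_card] at h1 h2
  change A.rank + _ = _ at h1
  change (A.submatrix e e).rank + _ = _ at h2
  rw [rank_submatrix, Fintype.card_congr e] at h2
  omega

theorem biperiodic_zero {n : ℕ} : (biperiodic 0 0 : Fin n → ℂ) = 0 := by
  ext i
  simp [biperiodic]

open scoped ComplexOrder in
theorem finrank_ker_mixedTridiagonal {n : ℕ} (w : Fin (n - 1) → ℂ) :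
    Module.finrank ℂ (LinearMap.ker
      (mixedTridiagonal 1 (biperiodic 0 0) w {j | Odd (j : ℕ)}).mulVecLin)
      + 2 * (bidiagonal w).rank = n := by
  have h := finrank_ker_fromBlocks_zero (bidiagonal w) (bidiagonal w)ᴴ
  rw [← finrank_ker_submatrix _ (parityEquiv n), mixedTridiagonal_submatrix_parityEquiv]
  rw [rank_conjTranspose] at h
  rw [zero_smul, zero_smul, one_smul]
  simp only [Fintype.card_fin] at h
  omega

end PathKernel

/-! ### The higher rank numerical ranges. -/

section Main

variable {n k : ℕ}

theorem mixedTridiagonal_sub_smul (ζ α β z : ℂ) (w : Fin (n - 1) → ℂ) (J : Finset (Fin (n - 1))) :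
    mixedTridiagonal ζ (biperiodic α β) w J - z • 1 =
      mixedTridiagonal ζ (biperiodic (α - z) (β - z)) w J := by
  ext i j
  by_cases h : i = j
  · subst h
    simp only [mixedTridiagonal, Matrix.sub_apply, Matrix.smul_apply, one_apply_eq,
      tridiagonal_apply_self, biperiodic, smul_eq_mul, mul_one]
    split_ifs <;> rfl
  · simp [mixedTridiagonal, tridiagonal, h]

theorem mem_range_mixedTridiagonal_iff {ζ α β z : ℂ} {w : Fin (n - 1) → ℂ}
    {J : Finset (Fin (n - 1))} :
    z ∈ higherRankNumericalRange k (mixedTridiagonal ζ (biperiodic α β) w J) ↔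
      HasIsotropicFrame ((mixedTridiagonal ζ (biperiodic (α - z) (β - z)) w J).submatrix
        (parityEquiv n) (parityEquiv n)) k := by
  rw [mem_higherRankNumericalRange_iff, mixedTridiagonal_sub_smul, hasIsotropicFrame_submatrix]

theorem mixedTridiagonal_parityEquiv_inl (ζ a b : ℂ) (w : Fin (n - 1) → ℂ)
    (J : Finset (Fin (n - 1))) (i j : Fin ((n + 1) / 2)) :
    (mixedTridiagonal ζ (biperiodic a b) w J).submatrix (parityEquiv n) (parityEquiv n)
      (Sum.inl i) (Sum.inl j) = if i = j then a else 0 := by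
  simp only [submatrix_apply, mixedTridiagonal, parityEquiv, Equiv.coe_fn_mk, Sum.elim_inl]
  by_cases h : i = j
  · subst h
    rw [tridiagonal_apply_self]
    simp [biperiodic]
  · have h' : (i : ℕ) ≠ j := fun h' => h (Fin.ext h')
    rw [tridiagonal_apply_of_ne, if_neg h]
    · simp [h']
    · simp; omega
    · simp; omega

theorem mixedTridiagonal_parityEquiv_inr (ζ a b : ℂ) (w : Fin (n - 1) → ℂ)
    (J : Finset (Fin (n - 1))) (i j : Fin (n / 2)) :
    (mixedTridiagonal ζ (biperiodic a b) w J).submatrix (parityEquiv n) (parityEquiv n)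
      (Sum.inr i) (Sum.inr j) = if i = j then b else 0 := by
  simp only [submatrix_apply, mixedTridiagonal, parityEquiv, Equiv.coe_fn_mk, Sum.elim_inr]
  by_cases h : i = j
  · subst h
    rw [tridiagonal_apply_self]
    simp [biperiodic]
  · have h' : (i : ℕ) ≠ j := fun h' => h (Fin.ext h')
    rw [tridiagonal_apply_of_ne, if_neg h]
    · simp [h']
    · simp; omega
    · simp; omega

/-- The subspace contains a nonzero `v` vanishing on `K`, and the form at `v` is `a‖v‖²`. -/
theorem HasIsotropicFrame.eq_zero {m : Type*} [Fintype m] [DecidableEq m] {A : Matrix m m ℂ}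
    {a : ℂ} (h : HasIsotropicFrame A k) (K : Finset m) (hK : K.card < k)
    (hA : ∀ i ∉ K, ∀ j ∉ K, A i j = if i = j then a else 0) : a = 0 := by
  obtain ⟨v, hv0, hvK, hv⟩ := h.exists_vector K hK
  have h1 : star v ⬝ᵥ A *ᵥ v = a * star v ⬝ᵥ v := by
    rw [dotProduct, dotProduct, Finset.mul_sum]
    refine Finset.sum_congr rfl fun i _ => ?_
    by_cases hi : i ∈ K
    · simp [hvK i hi]
    · have : (A *ᵥ v) i = a * v i := by
        rw [mulVec, dotProduct, Finset.sum_eq_single i]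
        · rw [hA i hi i hi, if_pos rfl]
        · intro j _ hj
          by_cases hjK : j ∈ K
          · simp [hvK j hjK]
          · rw [hA i hi j hjK, if_neg hj.symm, zero_mul]
        · simp
      rw [this]
      ring
  rw [h1, star_dotProduct_self_eq] at hv
  refine (mul_eq_zero.1 hv).resolve_right fun h2 => hv0 ?_
  have h3 := (Finset.sum_eq_zero_iff_of_nonneg fun i _ => sq_nonneg _).1 (Complex.ofReal_eq_zero.1 h2)
  ext i
  simpa using h3 i (Finset.mem_univ i)

variable (ζ α β : ℂ) (w : Fin (n - 1) → ℂ) (J : Finset (Fin (n - 1)))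

theorem left_mem_range_mixedTridiagonal (hk : k ≤ (n + 1) / 2) :
    α ∈ higherRankNumericalRange k (mixedTridiagonal ζ (biperiodic α β) w J) := by
  rw [mem_range_mixedTridiagonal_iff]
  refine hasIsotropicFrame_of_coordinates (Finset.univ.map Function.Embedding.inl) (by simpa) ?_
  simp only [Finset.mem_map, Finset.mem_univ, true_and, Function.Embedding.inl_apply,
    forall_exists_index, forall_apply_eq_imp_iff]
  intro i j
  rw [mixedTridiagonal_parityEquiv_inl]
  simp

theorem right_mem_range_mixedTridiagonal (hk : k ≤ n / 2) :
    β ∈ higherRankNumericalRange k (mixedTridiagonal ζ (biperiodic α β) w J) := by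
  rw [mem_range_mixedTridiagonal_iff]
  refine hasIsotropicFrame_of_coordinates (Finset.univ.map Function.Embedding.inr) (by simpa) ?_
  simp only [Finset.mem_map, Finset.mem_univ, true_and, Function.Embedding.inr_apply,
    forall_exists_index, forall_apply_eq_imp_iff]
  intro i j
  rw [mixedTridiagonal_parityEquiv_inr]
  simp

variable {ζ α β w J}

theorem eq_left_of_mem_range_mixedTridiagonal (hk : n / 2 < k) {z : ℂ}
    (hz : z ∈ higherRankNumericalRange k (mixedTridiagonal ζ (biperiodic α β) w J)) : z = α := by
  rw [mem_range_mixedTridiagonal_iff] at hz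
  refine (sub_eq_zero.1 (hz.eq_zero (Finset.univ.map Function.Embedding.inr) (by simpa) ?_)).symm
  rintro (i | i) hi (j | j) hj
  · rw [mixedTridiagonal_parityEquiv_inl]
    simp
  all_goals simp at hi hj

theorem eq_right_of_mem_range_mixedTridiagonal (hk : (n + 1) / 2 < k) {z : ℂ}
    (hz : z ∈ higherRankNumericalRange k (mixedTridiagonal ζ (biperiodic α β) w J)) : z = β := by
  rw [mem_range_mixedTridiagonal_iff] at hz
  refine (sub_eq_zero.1 (hz.eq_zero (Finset.univ.map Function.Embedding.inl) (by simpa) ?_)).symm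
  rintro (i | i) hi (j | j) hj
  on_goal 4 =>
    rw [mixedTridiagonal_parityEquiv_inr]
    simp
  all_goals simp at hi hj

variable (ζ α β w J)

theorem range_mixedTridiagonal_eq_discImage (hk : 1 ≤ k) (hkn : k ≤ n / 2) :
    higherRankNumericalRange k (mixedTridiagonal ζ (biperiodic α β) w J) =
      discImage α β ζ (singularValue (bidiagonal w) k) := by
  ext z
  -- At `z = α` or `z = β` the congruence is unavailable, as the diagonal has zeros; these points
  -- are the values at `u = 1` and `u = -1`.
  by_cases hα : z = α
  · subst hα
    refine iff_of_true (left_mem_range_mixedTridiagonal ζ z β w J (by omega)) ⟨1, 0, by simp, ?_⟩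
    simp only [Complex.ofReal_one, map_zero]
    ring
  by_cases hβ : z = β
  · subst hβ
    refine iff_of_true (right_mem_range_mixedTridiagonal ζ α z w J hkn) ⟨-1, 0, by simp, ?_⟩
    simp only [Complex.ofReal_neg, Complex.ofReal_one, map_zero]
    ring
  have ha : ∀ i : Fin n, biperiodic (α - z) (β - z) i ≠ 0 := by
    intro i
    simp only [biperiodic]
    split_ifs
    · exact sub_ne_zero.2 (Ne.symm hα)
    · exact sub_ne_zero.2 (Ne.symm hβ)
  have hs : StrictMono (fun j : ℕ => j + 1) := strictMono_id.add_const 1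
  have hmain := hasIsotropicFrame_rectDiagonal_iff (show n / 2 ≤ (n + 1) / 2 by omega) hk hkn
    (σ := fun j => singularValue (bidiagonal w) (j + 1))
    ((singularValue_antitone _).comp_monotone hs.monotone)
    (fun j => singularValue_nonneg _ _) α β ζ z
  simp only [Nat.sub_add_cancel hk] at hmain
  rw [mem_range_mixedTridiagonal_iff, hasIsotropicFrame_submatrix,
    (mixedTridiagonal_starCongruent ha w J {j | Odd (j : ℕ)}).hasIsotropicFrame_iff,
    ← hasIsotropicFrame_submatrix (parityEquiv n), mixedTridiagonal_submatrix_parityEquiv,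
    (starCongruent_rectDiagonal (by omega) _ _ _ _).hasIsotropicFrame_iff, hmain]

/-- A pencil of `A` and its adjoint contains a tridiagonal matrix with zero diagonal and the full
support of `w`. -/
theorem exists_tridiagonal_of_hasIsotropicFrame
    (h : HasIsotropicFrame (mixedTridiagonal ζ 0 w J) k) :
    ∃ c d : Fin (n - 1) → ℂ, (∀ j, c j = 0 ↔ w j = 0) ∧ (∀ j, d j = 0 ↔ w j = 0) ∧
      HasIsotropicFrame (tridiagonal d 0 c) k := by
  -- For `ζ = 0` the matrix itself has too small a support. An isotropic subspace of `A` is also one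
  -- of `A + A*`, whose entries carry the factor `1 + ζ` or its conjugate; only for `ζ = -1` is `A`
  -- itself used.
  by_cases hζ : ζ = -1
  · subst hζ
    refine ⟨_, _, fun j => ?_, fun j => ?_, h⟩
    · split_ifs <;> simp
    · split_ifs <;> simp
  · have h1 : 1 + ζ ≠ 0 := fun h => hζ (by linear_combination h)
    have h2 : 1 + conj ζ ≠ 0 := fun h => h1 (by
      have := congrArg conj h
      simpa using this)
    refine ⟨fun j => if j ∈ J then (1 + ζ) * conj (w j) else (1 + conj ζ) * w j,
      fun j => if j ∈ J then (1 + conj ζ) * w j else (1 + ζ) * conj (w j), fun j => ?_,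
      fun j => ?_, ?_⟩
    · dsimp only
      split_ifs <;> simp [h1, h2]
    · dsimp only
      split_ifs <;> simp [h1, h2]
    · obtain ⟨V, hV, h0⟩ := h
      refine ⟨V, hV, ?_⟩
      have hA : tridiagonal (fun j => if j ∈ J then (1 + conj ζ) * w j else (1 + ζ) * conj (w j)) 0
          (fun j => if j ∈ J then (1 + ζ) * conj (w j) else (1 + conj ζ) * w j) =
          mixedTridiagonal ζ 0 w J + (mixedTridiagonal ζ 0 w J)ᴴ := by
        ext i j
        simp only [Matrix.add_apply, conjTranspose_apply, mixedTridiagonal]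
        by_cases h1 : (i : ℕ) + 1 = j
        · rw [tridiagonal_apply_succ _ _ _ h1, tridiagonal_apply_succ _ _ _ h1,
            tridiagonal_succ_apply _ _ _ h1]
          split_ifs <;> simp <;> ring
        by_cases h2 : (j : ℕ) + 1 = i
        · rw [tridiagonal_succ_apply _ _ _ h2, tridiagonal_apply_succ _ _ _ h2,
            tridiagonal_succ_apply _ _ _ h2]
          split_ifs <;> simp <;> ring
        by_cases h : i = j
        · subst h
          simp [tridiagonal_apply_self]
        · rw [tridiagonal_apply_of_ne _ _ _ h h1 h2, tridiagonal_apply_of_ne _ _ _ h h1 h2,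
            tridiagonal_apply_of_ne _ _ _ (Ne.symm h) h2 h1]
          simp
      have h3 : Vᴴ * (mixedTridiagonal ζ 0 w J)ᴴ * V = 0 := by
        have := congrArg conjTranspose h0
        rwa [conjTranspose_mul, conjTranspose_mul, conjTranspose_conjTranspose,
          conjTranspose_zero, ← Matrix.mul_assoc] at this
      rw [hA, Matrix.mul_add, Matrix.add_mul, h0, h3, add_zero]

/-- Both sides amount to `k ≤ |I|`: the coordinates in `I` span an isotropic subspace, and the
kernel bound excludes a larger one. -/
theorem mem_range_mixedTridiagonal_self_iff :
    α ∈ higherRankNumericalRange k (mixedTridiagonal ζ (biperiodic α α) w J) ↔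
      k + (bidiagonal w).rank ≤ n := by
  obtain ⟨I, u, hcard, hI, hker⟩ := exists_independent_set_tridiagonal w
  have hframe : ∀ (ζ : ℂ) (J : Finset (Fin (n - 1))) (k : ℕ), k ≤ I.card →
      HasIsotropicFrame (mixedTridiagonal ζ 0 w J) k := by
    intro ζ J k hk
    refine hasIsotropicFrame_of_coordinates I hk fun i hi j hj => ?_
    rw [mixedTridiagonal]
    by_cases h1 : (i : ℕ) + 1 = j
    · rw [tridiagonal_apply_succ _ _ _ h1, hI i hi j hj h1]
      simp
    by_cases h2 : (j : ℕ) + 1 = i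
    · rw [tridiagonal_succ_apply _ _ _ h2, hI j hj i hi h2]
      simp
    by_cases h : i = j
    · subst h
      simp [tridiagonal_apply_self]
    · rw [tridiagonal_apply_of_ne _ _ _ h h1 h2]
  have hrank := finrank_ker_mixedTridiagonal w
  rw [biperiodic_zero] at hrank
  -- For `ζ = 1` the kernel has dimension `n - 2p`; the two bounds identify it with `u`, whence `|I|
  -- = n - p`.
  have h1 := (hframe 1 {j | Odd (j : ℕ)} _ le_rfl).two_mul_le
  have h2 := hker (fun j => if j ∈ ({j | Odd (j : ℕ)} : Finset (Fin (n - 1)))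
      then 1 * conj (w j) else w j)
    (fun j => if j ∈ ({j | Odd (j : ℕ)} : Finset (Fin (n - 1))) then w j else 1 * conj (w j))
    (fun j => by split_ifs <;> simp) (fun j => by split_ifs <;> simp)
  change Module.finrank ℂ (LinearMap.ker (mixedTridiagonal 1 0 w _).mulVecLin) ≤ u at h2
  rw [Fintype.card_fin] at h1
  rw [mem_higherRankNumericalRange_iff, mixedTridiagonal_sub_smul, sub_self, biperiodic_zero]
  constructor
  · intro h
    obtain ⟨c, d, hc, hd, h'⟩ := exists_tridiagonal_of_hasIsotropicFrame ζ w J h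
    have h3 := h'.two_mul_le
    have h4 := hker c d hc hd
    rw [Fintype.card_fin] at h3
    omega
  · intro h
    exact hframe ζ J k (by omega)

end Main

theorem corollary3p4 (n : ℕ) (α β ζ : ℂ) (c d : Fin (n - 1) → ℂ) (J₁ : Finset (Fin (n - 1)))
    (hJ₁ : ∀ j ∈ J₁, c j = ζ * conj (d j))
    (hJ₂ : ∀ j ∉ J₁, d j = ζ * conj (c j)) :
    let T : Matrix (Fin n) (Fin n) ℂ := tridiagonal d (biperiodic α β) c
    let c' : Fin (n - 1) → ℂ := fun j => if j ∈ J₁ then d j else c j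
    let s : ℕ → ℝ := singularValue (bidiagonal c')
    let p : ℕ := (bidiagonal c').rank
    -- the elliptical discs; `δ` is either square root of the discriminant
    (∀ k : ℕ, 1 ≤ k → k ≤ p → ∀ δ : ℂ, δ ^ 2 = (α - β) ^ 2 + 4 * ζ * (s k : ℂ) ^ 2 →
      IsEllipticalDisc (higherRankNumericalRange k T)
        ((α + β) / 2 + δ / 2) ((α + β) / 2 - δ / 2)
        (√(‖α - β‖ ^ 2 / 2 + (1 + ‖ζ‖ ^ 2) * s k ^ 2
          + ‖(α - β) ^ 2 + 4 * ζ * (s k : ℂ) ^ 2‖ / 2))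
        (√(‖α - β‖ ^ 2 / 2 + (1 + ‖ζ‖ ^ 2) * s k ^ 2
          - ‖(α - β) ^ 2 + 4 * ζ * (s k : ℂ) ^ 2‖ / 2))) ∧
    -- odd order
    (∀ r : ℕ, n = 2 * r + 1 → ∀ k : ℕ,
      (p < k → k ≤ r → higherRankNumericalRange k T = segment ℝ α β) ∧
      (r < k → k ≤ r + 1 → higherRankNumericalRange k T = {α}) ∧
      (r + 1 < k → k ≤ n → (α ≠ β ∨ n - p < k) → higherRankNumericalRange k T = ∅) ∧
      (r + 1 < k → α = β → k ≤ n - p → higherRankNumericalRange k T = {α})) ∧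
    -- even order
    (∀ r : ℕ, n = 2 * r → ∀ k : ℕ,
      (p < k → k ≤ r → higherRankNumericalRange k T = segment ℝ α β) ∧
      (r < k → k ≤ n → (α ≠ β ∨ n - p < k) → higherRankNumericalRange k T = ∅) ∧
      (r < k → α = β → k ≤ n - p → higherRankNumericalRange k T = {α})) := by
  intro T c' s p
  have hT : T = mixedTridiagonal ζ (biperiodic α β) c' J₁ := by
    have h1 : (fun j => if j ∈ J₁ then c' j else ζ * conj (c' j)) = d := by
      ext j
      by_cases hj : j ∈ J₁
      · simp [c', hj]
      · simp [c', hj, hJ₂ j hj]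
    have h2 : (fun j => if j ∈ J₁ then ζ * conj (c' j) else c' j) = c := by
      ext j
      by_cases hj : j ∈ J₁
      · simp [c', hj, hJ₁ j hj]
      · simp [c', hj]
    rw [mixedTridiagonal, h1, h2]
  have hp : p ≤ n / 2 := by
    simpa using (bidiagonal c').rank_le_card_width
  have hseg : ∀ k, p < k → k ≤ n / 2 → higherRankNumericalRange k T = segment ℝ α β := by
    intro k hpk hk
    rw [hT, range_mixedTridiagonal_eq_discImage _ _ _ _ _ (by omega) hk,
      singularValue_eq_zero_of_rank_lt _ hpk, discImage_zero]
  have hempty : ∀ k, (n + 1) / 2 < k → (α ≠ β ∨ n - p < k) →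
      higherRankNumericalRange k T = ∅ := by
    intro k hk h
    rw [hT, Set.eq_empty_iff_forall_notMem]
    intro z hz
    have h1 := eq_left_of_mem_range_mixedTridiagonal (by omega) hz
    have h2 := eq_right_of_mem_range_mixedTridiagonal hk hz
    subst h1
    subst h2
    have := (mem_range_mixedTridiagonal_self_iff ζ z c' J₁).1 hz
    change k + p ≤ n at this
    rcases h with h | h
    · exact h rfl
    · omega
  have hsingle : ∀ k, (n + 1) / 2 < k → α = β → k ≤ n - p →
      higherRankNumericalRange k T = {α} := by
    intro k hk h hkp
    rw [hT, Set.eq_singleton_iff_unique_mem]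
    refine ⟨?_, fun z hz => eq_left_of_mem_range_mixedTridiagonal (by omega) hz⟩
    subst h
    refine (mem_range_mixedTridiagonal_self_iff ζ α c' J₁).2 ?_
    change k + p ≤ n
    omega
  refine ⟨?_, ?_, ?_⟩
  · intro k hk hkp δ hδ
    rw [hT, range_mixedTridiagonal_eq_discImage _ _ _ _ _ hk (hkp.trans hp)]
    exact isEllipticalDisc_discImage α β ζ (s k) hδ
  · intro r hr k
    refine ⟨fun h1 h2 => hseg k h1 (by omega), fun h1 h2 => ?_,
      fun h1 _ h2 => hempty k (by omega) h2, fun h1 h2 h3 => hsingle k (by omega) h2 h3⟩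
    rw [hT, Set.eq_singleton_iff_unique_mem]
    exact ⟨left_mem_range_mixedTridiagonal _ _ _ _ _ (by omega),
      fun z hz => eq_left_of_mem_range_mixedTridiagonal (by omega) hz⟩
  · intro r hr k
    exact ⟨fun h1 h2 => hseg k h1 (by omega), fun h1 _ h2 => hempty k (by omega) h2,
      fun h1 h2 h3 => hsingle k (by omega) h2 h3⟩
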